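/- Fix $d\ge 1$. A flow is a measure-preserving action $T=\{T_t\}_{t\in\mathbb R^d}$ of the group $\mathbb R^d$ on a standard (Lebesgue) probability space $(X,\mathcal B,\mu)$ which is continuous: the operators $f\mapsto f\circ T_t$ on $L^2(X,\mu)$ converge weakly to the identity as $t\to 0$. The flow is weakly mixing if the action $T_t\times T_t$ on $(X\times X,\mu\otimes\mu)$ is ergodic; it is mixing if $\mu(A\cap T_t^{-1}B)\to\mu(A)\mu(B)$ as $t\to\infty$ in $\mathbb R^d$ for all measurable $A,B$; it is mixing with multiplicity $k$ if for all measurable $A_0,\dots,A_k$ and all sequences $t_0(m),\dots,t_k(m)$ in $\mathbb R^d$ with $|t_p(m)-t_q(m)|\to\infty$ for $p\ne q$, $$\mu\Bigl(\bigcap_{p=0}^k T_{t_p(m)}^{-1}A_p\Bigr)\to\prod_{p=0}^k\mu(A_p)\qquad(m\to\infty).$$ A joining of $n$ copies of $T$ is a probability measure on $X^n$ that is invariant under $T_t\times\dots\times T_t$ for all $t$ and whose projection to each factor is $\mu$; it is ergodic if it is ergodic under this diagonal action. For a measurable $S:X\to X$ preserving $\mu$ let $\Delta_S$ be the image of $\mu$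 under $x\mapsto(x,Sx)$. The flow is $n$-simple (simple of order $n$) if every ergodic joining $\nu\ne\mu^{\otimes n}$ of $n$ copies of $T$ has a projection onto a two-dimensional face of $X^n$ equal to $\Delta_S$ for some automorphism $S$ of $(X,\mu)$ commuting with the flow. It has minimal self-joinings of order $n$, written $T\in MSJ(n)$, if every such $\nu$ has a projection onto a two-dimensional face equal to $\Delta_{T_t}$ for some $t\in\mathbb R^d$. Theorem. 1. A weakly mixing 2-simple flow is simple of order $n$ for every $n\ge 2$. 2. A mixing 2-simple flow is mixing with every multiplicity $k\ge 1$. 3. For weakly mixing flows the classes $MSJ(n)$, $n\ge2$, coincide: for every $n\ge 2$, a weakly mixing flow belongs to $MSJ(2)$ if and only if it belongs to $MSJ(n)$; in particular $MSJ(2)=MSJ(3)$. -/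

import Mathlib

open MeasureTheory Filter Topology

/-- A measure-preserving flow: an action of a topological additive group `G` (below always `ℝ^d`)
on a probability space `(X, μ)` by measurable `μ`-preserving transformations `x ↦ t +ᵥ x`, which is
continuous: the operators `f ↦ f (t +ᵥ ·)` on `L²(X, μ)` converge weakly to the identity
as `t → 0`. -/
structure IsFlow (G : Type*) [AddGroup G] [TopologicalSpace G] {X : Type*} [AddAction G X]
    [MeasurableSpace X] (μ : Measure X) : Prop where
  measurePreserving : ∀ t : G, MeasurePreserving (fun x : X => t +ᵥ x) μ μ
  continuous : ∀ f g : X → ℝ, MemLp f 2 μ → MemLp g 2 μ →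
    Tendsto (fun t : G => ∫ x, f (t +ᵥ x) * g x ∂μ) (𝓝 0) (𝓝 (∫ x, f x * g x ∂μ))

/-- Weak mixing: the diagonal action on `(X × X, μ ⊗ μ)` is ergodic. -/
def IsWeaklyMixing (G : Type*) [AddGroup G] {X : Type*} [AddAction G X]
    [MeasurableSpace X] (μ : Measure X) : Prop :=
  ErgodicVAdd G (X × X) (μ.prod μ)

/-- Mixing: `μ (A ∩ T_t⁻¹ B) → μ A * μ B` as `t → ∞`. -/
def IsMixing (G : Type*) [AddGroup G] [TopologicalSpace G] {X : Type*} [AddAction G X]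
    [MeasurableSpace X] (μ : Measure X) : Prop :=
  ∀ A B : Set X, MeasurableSet A → MeasurableSet B →
    Tendsto (fun t : G => μ (A ∩ (fun x => t +ᵥ x) ⁻¹' B)) (cocompact G) (𝓝 (μ A * μ B))

/-- Mixing with multiplicity `k`: for all measurable `A 0, …, A k` and all sequences of times
`t 0, …, t k` whose pairwise differences tend to infinity, the measure of
`⋂ p, T_{t p}⁻¹ (A p)` tends to the product of the measures of the `A p`.
(Replacing all times by their negatives shows that preimages may be replaced by images.) -/
def IsMixingWithMultiplicity (G : Type*) [AddGroup G] [TopologicalSpace G] {X : Type*}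
    [AddAction G X] [MeasurableSpace X] (μ : Measure X) (k : ℕ) : Prop :=
  ∀ A : Fin (k + 1) → Set X, (∀ p, MeasurableSet (A p)) →
    ∀ t : Fin (k + 1) → ℕ → G,
      (∀ p q, p ≠ q → Tendsto (fun m => t p m - t q m) atTop (cocompact G)) →
      Tendsto (fun m => μ (⋂ p, (fun x => t p m +ᵥ x) ⁻¹' (A p))) atTop (𝓝 (∏ p, μ (A p)))

/-- A joining of `n` copies of the action (a self-joining of order `n`): a probability measure on
`X ^ n`, invariant under the diagonal action, all of whose one-dimensional projections are `μ`. -/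
structure IsSelfJoining (G : Type*) [AddGroup G] {X : Type*} [AddAction G X]
    [MeasurableSpace X] (μ : Measure X) (n : ℕ) (ν : Measure (Fin n → X)) : Prop where
  isProbabilityMeasure : IsProbabilityMeasure ν
  invariant : ∀ t : G, MeasurePreserving (fun x : Fin n → X => t +ᵥ x) ν ν
  marginal : ∀ i : Fin n, ν.map (fun x => x i) = μ

/-- The joining `ν` is ergodic with respect to the diagonal action on `X ^ n`. -/
def IsErgodicSelfJoining (G : Type*) [AddGroup G] {X : Type*} [AddAction G X]
    [MeasurableSpace X] (μ : Measure X) (n : ℕ) (ν : Measure (Fin n → X)) : Prop :=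
  IsSelfJoining G μ n ν ∧ ErgodicVAdd G (Fin n → X) ν

/-- `S` is an automorphism of the probability space `(X, μ)` that commutes (mod 0) with the
action. -/
def IsCommutingAutomorphism (G : Type*) [AddGroup G] {X : Type*} [AddAction G X]
    [MeasurableSpace X] (μ : Measure X) (S : X ≃ᵐ X) : Prop :=
  MeasurePreserving S μ μ ∧ ∀ t : G, ∀ᵐ x ∂μ, S (t +ᵥ x) = t +ᵥ S x

/-- The shift `Δ_S = (Id × S) Δ` of the diagonal measure `Δ` on `X × X`. -/
noncomputable def diagonalShift {X : Type*} [MeasurableSpace X] (μ : Measure X) (S : X → X) :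
    Measure (X × X) :=
  μ.map (fun x => (x, S x))

/-- The action is `n`-simple: every ergodic joining of `n` copies, other than `μ^{⊗ n}`, has a
two-dimensional projection of the form `Δ_S` for an automorphism `S` commuting with the action. -/
def IsSimpleOfOrder (G : Type*) [AddGroup G] {X : Type*} [AddAction G X]
    [MeasurableSpace X] (μ : Measure X) (n : ℕ) : Prop :=
  ∀ ν : Measure (Fin n → X), IsErgodicSelfJoining G μ n ν → ν ≠ Measure.pi (fun _ => μ) →
    ∃ i j : Fin n, i ≠ j ∧ ∃ S : X ≃ᵐ X, IsCommutingAutomorphism G μ S ∧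
      ν.map (fun x => (x i, x j)) = diagonalShift μ S

/-- Minimal self-joinings of order `n` (the class `MSJ(n)`): every ergodic joining of `n` copies,
other than `μ^{⊗ n}`, has a two-dimensional projection of the form `Δ_{T_t}`, where `T_t` is an
element of the action. -/
def HasMinimalSelfJoinings (G : Type*) [AddGroup G] {X : Type*} [AddAction G X]
    [MeasurableSpace X] (μ : Measure X) (n : ℕ) : Prop :=
  ∀ ν : Measure (Fin n → X), IsErgodicSelfJoining G μ n ν → ν ≠ Measure.pi (fun _ => μ) →
    ∃ i j : Fin n, i ≠ j ∧ ∃ t : G,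
      ν.map (fun x => (x i, x j)) = diagonalShift μ (fun x => t +ᵥ x)

open scoped ENNReal

/-! Everything rests on `IsSimpleOfOrder.eq_prod_of_pairwise_independent`, about an ergodic joining
`ν` of two copies of the flow and a third system `Z` whose pairs are all independent. If `ν` is not
the product, disintegrate it over the last two coordinates into fibre measures `κ u` on `X`. Some
set `A` has `∫ κ_u(A)² ≠ μ(A)²`, and continuity of the flow gives `∫ κ_u(A) κ_{τ u}(A) ≠ μ(A)²` for
`τ (y, z) = (s + y, z)` with `s` small. So the relatively independent self-joining of `ν` over the
graph of `τ` correlates the two points `x, x'` of `X`; so does some ergodic joining over the same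
graph, and there 2-simplicity forces `x' = R x`. Hence `ν` is invariant under `(R, T_s, Id)`, at
first for small `s`, then by composition for all `s`. For fixed `C ⊆ Z`, the measure `ν(· × · × C)`
is dominated by `μ ⊗ μ` and invariant under `R × T_s`; weak mixing gives it product structure
(`IsWeaklyMixing.measure_prod_eq_of_le_prod`), and independence of `x` and `z` makes `ν` the
product.

Induction with `Z = X^{n-2}` shows that pairwise independent ergodic self-joinings are products. So
a nontrivial ergodic joining of order `n` has a nontrivial two-dimensional face, which gives
simplicity of all orders and the passage from `MSJ(2)` to `MSJ(n)`. The converse passage adjoins an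
independent copy of `X` to a joining. For multiple mixing, a limit of the laws of `(T_{t_0} x, …,
T_{t_k} x)` is a pairwise independent joining, hence the product.

Reduction to ergodic joinings is by Krein–Milman: joinings with prescribed ergodic faces form a
compact convex set whose extreme points are ergodic. -/

instance Prod.measurableConstVAdd {G X Y : Type*} [AddGroup G] [AddAction G X] [AddAction G Y]
    [MeasurableSpace X] [MeasurableSpace Y] [MeasurableConstVAdd G X] [MeasurableConstVAdd G Y] :
    MeasurableConstVAdd G (X × Y) :=
  ⟨fun c => ((measurable_const_vadd c).comp measurable_fst).prodMk
    ((measurable_const_vadd c).comp measurable_snd)⟩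

/-! ### Ergodic measures: invariant densities and equivariant images. -/

section Ergodic

variable {G : Type*} [AddGroup G]

/-- An almost everywhere invariant function for an ergodic action is almost everywhere constant. -/
theorem ErgodicVAdd.exists_ae_eq_const {Y : Type*} [AddAction G Y] [MeasurableSpace Y]
    {σ : Measure Y} (hσ : ErgodicVAdd G Y σ) {F : Y → ℝ≥0∞} (hF : Measurable F)
    (hinv : ∀ t : G, ∀ᵐ y ∂σ, F (t +ᵥ y) = F y) : ∃ c, ∀ᵐ y ∂σ, F y = c := by
  refine exists_eventuallyEq_const_of_forall_separating (l := ae σ) (f := F) MeasurableSet ?_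
  intro U hU
  have := hσ.aeconst_of_forall_preimage_vadd_ae_eq (hF hU) fun t => by
    filter_upwards [hinv t] with y hy
    exact propext (by
      change F (t +ᵥ y) ∈ U ↔ F y ∈ U
      rw [hy])
  rw [eventuallyConst_set] at this
  exact this

/-- A finite invariant measure that is absolutely continuous with respect to an ergodic
probability measure is a multiple of it. -/
theorem ErgodicVAdd.eq_smul_of_absolutelyContinuous {Y : Type*} [AddAction G Y]
    [MeasurableSpace Y] [MeasurableConstVAdd G Y] {σ β : Measure Y} [IsProbabilityMeasure σ]
    [IsFiniteMeasure β] (hσ : ErgodicVAdd G Y σ) (hac : β ≪ σ)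
    (hinv : ∀ t : G, β.map (fun y => t +ᵥ y) = β) : β = β Set.univ • σ := by
  -- The density `dβ/dσ` is invariant because the action preserves both measures, so ergodicity
  -- makes it constant.
  obtain ⟨c, hc⟩ := hσ.exists_ae_eq_const (Measure.measurable_rnDeriv β σ) fun t => by
    have h := (MeasurableEquiv.vadd (α := Y) t).measurableEmbedding.rnDeriv_map β σ
    have h1 : β.map (MeasurableEquiv.vadd (α := Y) t) = β := hinv t
    have h2 : σ.map (MeasurableEquiv.vadd (α := Y) t) = σ := (measurePreserving_vadd t σ).map_eq
    rw [h1, h2] at h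
    exact h
  have h : β = c • σ := by
    rw [← withDensity_const, ← withDensity_congr_ae hc, Measure.withDensity_rnDeriv_eq _ _ hac]
  rw [h]
  simp

/-- An invariant probability measure that is absolutely continuous with respect to an ergodic
probability measure is equal to it. -/
theorem ErgodicVAdd.eq_of_absolutelyContinuous {Y : Type*} [AddAction G Y]
    [MeasurableSpace Y] [MeasurableConstVAdd G Y] {σ β : Measure Y} [IsProbabilityMeasure σ]
    [IsProbabilityMeasure β] (hσ : ErgodicVAdd G Y σ) (hac : β ≪ σ)
    (hinv : ∀ t : G, β.map (fun y => t +ᵥ y) = β) : β = σ := by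
  simpa using hσ.eq_smul_of_absolutelyContinuous hac hinv

/-- The image of an ergodic measure under an equivariant map is ergodic. -/
theorem ErgodicVAdd.map_of_equivariant {Y V : Type*} [AddAction G Y] [AddAction G V]
    [MeasurableSpace Y] [MeasurableSpace V] [MeasurableConstVAdd G V] {ρ : Measure Y}
    (hρ : ErgodicVAdd G Y ρ) {f : Y → V} (hf : Measurable f)
    (heq : ∀ (t : G) (y : Y), f (t +ᵥ y) = t +ᵥ f y) : ErgodicVAdd G V (ρ.map f) := by
  have hpre : ∀ (t : G) (s : Set V), f ⁻¹' ((t +ᵥ ·) ⁻¹' s) = (t +ᵥ ·) ⁻¹' (f ⁻¹' s) := by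
    intro t s
    ext y
    simp [heq]
  refine { measure_preimage_vadd := ?_, aeconst_of_forall_preimage_vadd_ae_eq := ?_ }
  · intro t s hs
    rw [Measure.map_apply hf (measurable_const_vadd t hs), Measure.map_apply hf hs, hpre]
    exact hρ.measure_preimage_vadd t (hf hs)
  · intro s hs hinv
    have := hρ.aeconst_of_forall_preimage_vadd_ae_eq (hf hs) fun t => by
      rw [← hpre]
      exact ae_of_ae_map hf.aemeasurable (hinv t)
    rw [eventuallyConst_set] at this ⊢
    rw [ae_map_iff (p := fun y => y ∈ s) hf.aemeasurable hs,
      ae_map_iff (p := fun y => y ∉ s) hf.aemeasurable hs.compl]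
    exact this

theorem ErgodicVAdd.map_vadd_eq {Y : Type*} [AddAction G Y] [MeasurableSpace Y]
    [MeasurableConstVAdd G Y] {σ : Measure Y} (hσ : ErgodicVAdd G Y σ) (t : G) :
    σ.map (fun y => t +ᵥ y) = σ :=
  (measurePreserving_vadd t σ).map_eq

end Ergodic

/-! ### Rigidity of invariant densities under weak mixing. -/

section WeaklyMixing

variable {G : Type*} [AddGroup G] {X : Type*} [AddAction G X] [MeasurableSpace X]
  {μ : Measure X} [IsProbabilityMeasure μ]

theorem IsWeaklyMixing.ergodicVAdd [MeasurableConstVAdd G X] (hwm : IsWeaklyMixing G μ) : ErgodicVAdd G X μ := by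
  have := ErgodicVAdd.map_of_equivariant (G := G) hwm (f := Prod.fst) measurable_fst
    (fun t y => rfl)
  simpa using this

/-- The correlation kernel of an invariant density is almost everywhere constant. -/
theorem IsWeaklyMixing.exists_lintegral_mul_lintegral_eq {Ω : Type*} [MeasurableSpace Ω]
    (hwm : IsWeaklyMixing G μ)
    {ρ : Measure Ω} [IsProbabilityMeasure ρ] {F : Ω × X → ℝ≥0∞} (hF : Measurable F)
    (hinv : ∀ s : G, ∃ R : Ω ≃ᵐ Ω, MeasurePreserving R ρ ρ ∧
      ∀ᵐ p ∂(ρ.prod μ), F (R p.1, s +ᵥ p.2) = F p) :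
    ∃ c : ℝ≥0∞, ∀ B B' : Set X, MeasurableSet B → MeasurableSet B' →
      ∫⁻ x, (∫⁻ y in B, F (x, y) ∂μ) * (∫⁻ y in B', F (x, y) ∂μ) ∂ρ = c * μ B * μ B' := by
  let K : X × X → ℝ≥0∞ := fun q => ∫⁻ x, F (x, q.1) * F (x, q.2) ∂ρ
  have hKm' : Measurable fun p : (X × X) × Ω => F (p.2, p.1.1) * F (p.2, p.1.2) := by fun_prop
  have hKm : Measurable K := hKm'.lintegral_prod_right
  have hK : ∀ t : G, ∀ᵐ q ∂(μ.prod μ), K (t +ᵥ q) = K q := by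
    intro t
    obtain ⟨R, hR, hRF⟩ := hinv t
    have h1 : ∀ᵐ y ∂μ, ∀ᵐ x ∂ρ, F (R x, t +ᵥ y) = F (x, y) := by
      have h2 : ∀ᵐ p ∂(μ.prod ρ), F (R p.2, t +ᵥ p.1) = F p.swap := by
        have := (Measure.measurePreserving_swap (μ := μ) (ν := ρ)).quasiMeasurePreserving.ae hRF
        exact this
      exact Measure.ae_ae_of_ae_prod h2
    have h3 : ∀ᵐ q ∂(μ.prod μ), ∀ᵐ x ∂ρ, F (R x, t +ᵥ q.1) = F (x, q.1) :=
      Measure.quasiMeasurePreserving_fst.ae h1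
    have h4 : ∀ᵐ q ∂(μ.prod μ), ∀ᵐ x ∂ρ, F (R x, t +ᵥ q.2) = F (x, q.2) :=
      Measure.quasiMeasurePreserving_snd.ae h1
    filter_upwards [h3, h4] with q hq1 hq2
    change ∫⁻ x, F (x, t +ᵥ q.1) * F (x, t +ᵥ q.2) ∂ρ = ∫⁻ x, F (x, q.1) * F (x, q.2) ∂ρ
    -- The substitution `x ↦ R x` removes `R` from the kernel, so `K` is invariant under the
    -- diagonal action whichever `R` accompanies `t`.
    rw [← hR.lintegral_comp (by fun_prop)]
    refine lintegral_congr_ae ?_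
    filter_upwards [hq1, hq2] with x hx1 hx2
    rw [hx1, hx2]
  obtain ⟨c, hc⟩ := ErgodicVAdd.exists_ae_eq_const (G := G) hwm hKm hK
  refine ⟨c, fun B B' hB hB' => ?_⟩
  have e1 : ∀ x, (∫⁻ y in B, F (x, y) ∂μ) * (∫⁻ y in B', F (x, y) ∂μ)
      = ∫⁻ q in B ×ˢ B', F (x, q.1) * F (x, q.2) ∂(μ.prod μ) := by
    intro x
    rw [← Measure.prod_restrict, lintegral_prod_mul (f := fun y => F (x, y))
      (g := fun y => F (x, y)) (by fun_prop) (by fun_prop)]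
  simp_rw [e1]
  rw [lintegral_lintegral_swap (by fun_prop)]
  change ∫⁻ q in B ×ˢ B', K q ∂(μ.prod μ) = _
  rw [setLIntegral_congr_fun_ae (hB.prod hB') (g := fun _ => c)
    (by filter_upwards [hc] with q hq _ using hq)]
  simp [mul_assoc]

/-- An invariant measure dominated by `ρ ⊗ μ`, where the second coordinate is moved by a weakly
mixing action and the first one by arbitrary automorphisms, has product structure. -/
theorem IsWeaklyMixing.measure_prod_eq_of_le_prod [MeasurableConstVAdd G X]
    {Ω : Type*} [MeasurableSpace Ω] (hwm : IsWeaklyMixing G μ)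
    {ρ : Measure Ω} [IsProbabilityMeasure ρ] {β : Measure (Ω × X)} (hβ : β ≤ ρ.prod μ)
    (hinv : ∀ s : G, ∃ R : Ω ≃ᵐ Ω, MeasurePreserving R ρ ρ ∧
      β.map (fun p => (R p.1, s +ᵥ p.2)) = β)
    {A : Set Ω} {B : Set X} (hA : MeasurableSet A) (hB : MeasurableSet B) :
    β (A ×ˢ B) = μ B * β (A ×ˢ Set.univ) := by
  have : IsFiniteMeasure β := isFiniteMeasure_of_le _ hβ
  have hFm : Measurable (β.rnDeriv (ρ.prod μ)) := Measure.measurable_rnDeriv _ _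
  obtain ⟨c, hc⟩ := hwm.exists_lintegral_mul_lintegral_eq (ρ := ρ) hFm fun s => by
    obtain ⟨R, hR, hRβ⟩ := hinv s
    refine ⟨R, hR, ?_⟩
    let M : Ω × X ≃ᵐ Ω × X := R.prodCongr (MeasurableEquiv.vadd s)
    have h1 : β.map M = β := hRβ
    have h2 : (ρ.prod μ).map M = ρ.prod μ :=
      (hR.prod ⟨measurable_const_vadd s, hwm.ergodicVAdd.map_vadd_eq s⟩).map_eq
    have h := M.measurableEmbedding.rnDeriv_map β (ρ.prod μ)
    rw [h1, h2] at h
    exact h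
  have hF1 : ∀ᵐ x ∂ρ, ∀ᵐ y ∂μ, β.rnDeriv (ρ.prod μ) (x, y) ≤ 1 :=
    Measure.ae_ae_of_ae_prod (Measure.rnDeriv_le_one_of_le hβ)
  have hβF : (ρ.prod μ).withDensity (β.rnDeriv (ρ.prod μ)) = β :=
    Measure.withDensity_rnDeriv_eq _ _ (Measure.absolutelyContinuous_of_le hβ)
  revert hc hFm hF1 hβF
  generalize β.rnDeriv (ρ.prod μ) = F
  intro hFm hc hF1 hβF
  let h : Set X → Ω → ℝ≥0∞ := fun D x => ∫⁻ y in D, F (x, y) ∂μ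
  have hm : ∀ D, Measurable (h D) := fun D => hFm.lintegral_prod_right'
  have hh1 : ∀ D, ∀ᵐ x ∂ρ, h D x ≤ 1 := by
    intro D
    filter_upwards [hF1] with x hx
    calc h D x ≤ ∫⁻ y, F (x, y) ∂μ := setLIntegral_le_lintegral _ _
      _ ≤ ∫⁻ y, 1 ∂μ := lintegral_mono_ae hx
      _ = 1 := by simp
  have hform : ∀ D D', MeasurableSet D → MeasurableSet D' →
      ∫ x, (h D x).toReal * (h D' x).toReal ∂ρ = (c * μ D * μ D').toReal := by
    intro D D' hD hD'
    rw [← hc D D' hD hD']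
    simp_rw [← ENNReal.toReal_mul]
    refine integral_toReal ((hm D).mul (hm D')).aemeasurable ?_
    filter_upwards [hh1 D, hh1 D'] with x h1 h2
    exact ENNReal.mul_lt_top (h1.trans_lt ENNReal.one_lt_top) (h2.trans_lt ENNReal.one_lt_top)
  have hint : ∀ D D', Integrable (fun x => (h D x).toReal * (h D' x).toReal) ρ := by
    intro D D'
    refine Integrable.of_bound
      ((hm D).ennreal_toReal.mul (hm D').ennreal_toReal).aestronglyMeasurable 1 ?_
    filter_upwards [hh1 D, hh1 D'] with x h1 h2
    have h1' := ENNReal.toReal_mono ENNReal.one_ne_top h1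
    have h2' := ENNReal.toReal_mono ENNReal.one_ne_top h2
    rw [ENNReal.toReal_one] at h1' h2'
    rw [Real.norm_of_nonneg (by positivity)]
    exact mul_le_one₀ h1' ENNReal.toReal_nonneg h2'
  -- By `hform` the square expands to `c μ(B)² - 2 c μ(B)² + c μ(B)² = 0`, so the slice masses `h B`
  -- and `μ B * h univ` agree almost everywhere.
  have hsq : ∫ x, ((h B x).toReal - (μ B).toReal * (h Set.univ x).toReal) ^ 2 ∂ρ = 0 := by
    have e : ∀ x, ((h B x).toReal - (μ B).toReal * (h Set.univ x).toReal) ^ 2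
        = (h B x).toReal * (h B x).toReal
          - 2 * (μ B).toReal * ((h B x).toReal * (h Set.univ x).toReal)
          + (μ B).toReal ^ 2 * ((h Set.univ x).toReal * (h Set.univ x).toReal) := by
      intro x; ring
    simp_rw [e]
    rw [integral_add (f := fun x => (h B x).toReal * (h B x).toReal
        - 2 * (μ B).toReal * ((h B x).toReal * (h Set.univ x).toReal))
      ((hint B B).sub ((hint B Set.univ).const_mul _)) ((hint Set.univ Set.univ).const_mul _),
      integral_sub (hint B B) ((hint B Set.univ).const_mul _), integral_const_mul,
      integral_const_mul, hform B B hB hB, hform B _ hB .univ, hform _ _ .univ .univ]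
    simp only [measure_univ, mul_one, ENNReal.toReal_mul]
    ring
  have hae : ∀ᵐ x ∂ρ, h B x = μ B * h Set.univ x := by
    have h0 := (integral_eq_zero_iff_of_nonneg (fun x => sq_nonneg _) (by
      refine Integrable.of_bound (by
        exact (((hm B).ennreal_toReal.sub
          ((hm Set.univ).ennreal_toReal.const_mul _)).pow_const 2).aestronglyMeasurable) 1 ?_
      filter_upwards [hh1 B, hh1 Set.univ] with x h1 h2
      have h1' := ENNReal.toReal_mono ENNReal.one_ne_top h1
      have h2' := ENNReal.toReal_mono ENNReal.one_ne_top h2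
      rw [ENNReal.toReal_one] at h1' h2'
      have h3 : (μ B).toReal ≤ 1 := measureReal_le_one
      have h4 : (μ B).toReal * (h Set.univ x).toReal ≤ 1 :=
        mul_le_one₀ h3 ENNReal.toReal_nonneg h2'
      have h5 : 0 ≤ (μ B).toReal * (h Set.univ x).toReal := by positivity
      rw [Real.norm_of_nonneg (sq_nonneg _), sq_le_one_iff_abs_le_one, abs_le]
      constructor <;> linarith [ENNReal.toReal_nonneg (a := h B x)])).1 hsq
    filter_upwards [h0, hh1 B, hh1 Set.univ] with x hx h1 h2
    have hx' : (h B x).toReal = (μ B * h Set.univ x).toReal := by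
      rw [ENNReal.toReal_mul]
      exact sub_eq_zero.1 (pow_eq_zero_iff two_ne_zero |>.1 hx)
    exact (ENNReal.toReal_eq_toReal_iff' (h1.trans_lt ENNReal.one_lt_top).ne
      (ENNReal.mul_ne_top (measure_ne_top _ _) (h2.trans_lt ENNReal.one_lt_top).ne)).1 hx'
  have hval : ∀ D, MeasurableSet D → β (A ×ˢ D) = ∫⁻ x in A, h D x ∂ρ := by
    intro D hD
    rw [← hβF, withDensity_apply _ (hA.prod hD), ← Measure.prod_restrict,
      lintegral_prod _ hFm.aemeasurable]
  rw [hval B hB, hval _ .univ, ← lintegral_const_mul _ (hm _)]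
  exact lintegral_congr_ae (ae_restrict_of_ae hae)

/-- The product of an ergodic action and a weakly mixing one is ergodic. -/
theorem IsWeaklyMixing.ergodicVAdd_prod [MeasurableConstVAdd G X] {W : Type*}
    [MeasurableSpace W] [AddAction G W] [MeasurableConstVAdd G W] {ν : Measure W}
    [IsProbabilityMeasure ν] (hwm : IsWeaklyMixing G μ) (hν : ErgodicVAdd G W ν) :
    ErgodicVAdd G (W × X) (ν.prod μ) := by
  have hpres : ∀ t : G, MeasurePreserving (fun p : W × X => t +ᵥ p) (ν.prod μ) (ν.prod μ) := by
    intro t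
    have h2 : MeasurePreserving (fun y : X => t +ᵥ y) μ μ :=
      ⟨measurable_const_vadd t, hwm.ergodicVAdd.map_vadd_eq t⟩
    exact (measurePreserving_vadd t ν).prod h2
  refine { measure_preimage_vadd := fun t s hs => (hpres t).measure_preimage hs.nullMeasurableSet,
           aeconst_of_forall_preimage_vadd_ae_eq := fun {E} hE hinv => ?_ }
  -- An invariant set `E` is tested through this restriction: it turns out to be proportional to `ν
  -- ⊗ μ`, yet it vanishes on `Eᶜ`, so `E` is null or conull.
  let β := (ν.prod μ).restrict E
  have hβ : ∀ t : G, β.map (fun p : W × X => t +ᵥ p) = β := by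
    intro t
    ext s hs
    rw [Measure.map_apply (measurable_const_vadd t) hs,
      Measure.restrict_apply (measurable_const_vadd t hs), Measure.restrict_apply hs,
      ← (hpres t).measure_preimage (hs.inter hE).nullMeasurableSet, Set.preimage_inter]
    exact measure_congr ((ae_eq_refl _).inter (hinv t).symm)
  have hprod : ∀ A B, MeasurableSet A → MeasurableSet B →
      β (A ×ˢ B) = μ B * β (A ×ˢ Set.univ) := by
    intro A B hA hB
    refine hwm.measure_prod_eq_of_le_prod (ρ := ν) Measure.restrict_le_self (fun s => ?_) hA hB
    exact ⟨MeasurableEquiv.vadd s, measurePreserving_vadd s ν, hβ s⟩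
  have hfst : β.fst = β.fst Set.univ • ν := by
    refine hν.eq_smul_of_absolutelyContinuous ?_ fun t => ?_
    · have h : ν = (ν.prod μ).fst := by simp
      rw [h]
      exact (Measure.absolutelyContinuous_of_le Measure.restrict_le_self).map measurable_fst
    · nth_rw 2 [← hβ t]
      rw [Measure.fst, Measure.fst, Measure.map_map (measurable_const_vadd t) measurable_fst,
        Measure.map_map measurable_fst (measurable_const_vadd t)]
      rfl
  have hβeq : β = β.fst Set.univ • ν.prod μ := by
    have : β.fst.prod μ = β := Measure.prod_eq fun A B hA hB => by
      rw [hprod A B hA hB, Measure.fst_apply hA, mul_comm, Set.prod_univ]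
    rw [← this]
    nth_rw 1 [hfst]
    rw [Measure.prod_smul_left, this]
  have h0 : β Eᶜ = 0 := by simp [β, Measure.restrict_apply hE.compl]
  rw [hβeq] at h0
  rw [eventuallyConst_set]
  rw [Measure.smul_apply, smul_eq_mul, Measure.fst_univ] at h0
  rcases mul_eq_zero.1 h0 with h | h
  · right
    have hE0 : (ν.prod μ) E = 0 := by
      simpa [β] using h
    exact measure_eq_zero_iff_ae_notMem.1 hE0
  · left
    exact mem_ae_iff.2 h

end WeaklyMixing

/-! ### Compactness of couplings with fixed marginals. -/

section Compactness

/-- The error depends on the marginal `ν` only, not on the coupling `l`; this uniformity lets limits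
of couplings be computed on all measurable rectangles. -/
theorem measure_pi_le_add_of_marginal {W : Type*} [MeasurableSpace W] {N : ℕ} {ν : Measure W}
    {l : Measure (Fin N → W)} (hl : ∀ p, l.map (fun w => w p) = ν) {A B : Fin N → Set W}
    (hA : ∀ p, MeasurableSet (A p)) (hB : ∀ p, MeasurableSet (B p)) {ε : ℝ≥0∞}
    (hAB : ∀ p, ν (A p \ B p) ≤ ε) :
    l (Set.univ.pi A) ≤ l (Set.univ.pi B) + N * ε := by
  have hsub : Set.univ.pi A ⊆ Set.univ.pi B ∪ ⋃ p, (fun w : Fin N → W => w p) ⁻¹' (A p \ B p) := by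
    intro w hw
    by_cases h : w ∈ Set.univ.pi B
    · exact Or.inl h
    · right
      simp only [Set.mem_pi, Set.mem_univ, true_implies, not_forall] at h hw
      obtain ⟨p, hp⟩ := h
      exact Set.mem_iUnion.2 ⟨p, hw p, hp⟩
  calc l (Set.univ.pi A) ≤ _ := measure_mono hsub
    _ ≤ l (Set.univ.pi B) + l (⋃ p, (fun w : Fin N → W => w p) ⁻¹' (A p \ B p)) :=
      measure_union_le _ _
    _ ≤ l (Set.univ.pi B) + ∑ p : Fin N, l ((fun w : Fin N → W => w p) ⁻¹' (A p \ B p)) := by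
      gcongr
      exact measure_iUnion_fintype_le _ _
    _ ≤ l (Set.univ.pi B) + ∑ p : Fin N, ε := by
      gcongr with p
      rw [← Measure.map_apply (measurable_pi_apply p) ((hA p).diff (hB p)), hl p]
      exact hAB p
    _ = _ := by simp

theorem le_of_forall_le_add_mul {a b : ℝ≥0∞} {N : ℕ} (h : ∀ ε > 0, a ≤ b + N * ε) : a ≤ b := by
  refine ENNReal.le_of_forall_pos_le_add fun ε hε _ => ?_
  -- For `N = 0` the quotient is `∞`, and `N * (ε / N) ≤ ε` still holds.
  refine (h (ε / N) (ENNReal.div_pos (by simpa using hε.ne') (by simp))).trans ?_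
  gcongr
  exact ENNReal.mul_div_le

/-- A compact `K` carrying all but `ε / N` of `ν` gives the compact cube `K ^ N`, which every
coupling charges up to `ε`. -/
theorem isTightMeasureSet_of_marginal {W : Type*} [TopologicalSpace W] [PolishSpace W]
    [MeasurableSpace W] [BorelSpace W] {N : ℕ} {ν : Measure W} [IsProbabilityMeasure ν] :
    IsTightMeasureSet {l : Measure (Fin N → W) | ∀ p, l.map (fun w => w p) = ν} := by
  let := TopologicalSpace.upgradeIsCompletelyMetrizable W
  rw [isTightMeasureSet_iff_exists_isCompact_measure_compl_le]
  intro ε hε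
  obtain ⟨K, hK, hKν⟩ := isTightMeasureSet_iff_exists_isCompact_measure_compl_le.1
    (isTightMeasureSet_singleton (μ := ν)) (ε / N) (ENNReal.div_pos hε.ne' (by simp))
  refine ⟨Set.univ.pi fun _ => K, isCompact_univ_pi fun _ => hK, fun l hl => ?_⟩
  have hsub : (Set.univ.pi fun _ : Fin N => K)ᶜ ⊆ ⋃ p, (fun w : Fin N → W => w p) ⁻¹' Kᶜ := by
    intro w hw
    simpa using hw
  calc l (Set.univ.pi fun _ => K)ᶜ ≤ _ := measure_mono hsub
    _ ≤ ∑ p : Fin N, l ((fun w : Fin N → W => w p) ⁻¹' Kᶜ) := measure_iUnion_fintype_le _ _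
    _ ≤ ∑ p : Fin N, ε / N := by
      gcongr with p
      rw [← Measure.map_apply (measurable_pi_apply p) hK.measurableSet.compl, hl p]
      exact hKν ν rfl
    _ ≤ ε := by
      simp only [Finset.sum_const, Finset.card_univ, Fintype.card_fin, nsmul_eq_mul]
      exact ENNReal.mul_div_le

/-- Couplings of copies of a measure on a standard Borel space converge along ultrafilters, in the
sense of convergence on all measurable rectangles. -/
theorem exists_tendsto_measure_pi_of_marginal {W : Type*} [MeasurableSpace W]
    [StandardBorelSpace W] {N : ℕ} {ν : Measure W} [IsProbabilityMeasure ν] {ι : Type*}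
    (U : Ultrafilter ι) {l : ι → Measure (Fin N → W)} (hprob : ∀ i, IsProbabilityMeasure (l i))
    (hl : ∀ i p, (l i).map (fun w => w p) = ν) :
    ∃ l' : Measure (Fin N → W), IsProbabilityMeasure l' ∧ (∀ p, l'.map (fun w => w p) = ν) ∧
      ∀ A : Fin N → Set W, (∀ p, MeasurableSet (A p)) →
        Tendsto (fun i => l i (Set.univ.pi A)) U (𝓝 (l' (Set.univ.pi A))) := by
  let := upgradeStandardBorel W
  let := TopologicalSpace.upgradeIsCompletelyMetrizable W
  let P : ι → ProbabilityMeasure (Fin N → W) := fun i => ⟨l i, hprob i⟩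
  have hcomp : IsCompact (closure (Set.range P)) := by
    refine isCompact_closure_of_isTightMeasureSet (isTightMeasureSet_of_marginal (ν := ν).subset ?_)
    rintro _ ⟨_, ⟨i, rfl⟩, rfl⟩
    exact hl i
  obtain ⟨P', -, hP'⟩ := isCompact_iff_ultrafilter_le_nhds.1 hcomp (U.map P) (by
    rw [le_principal_iff]
    exact mem_of_superset (Ultrafilter.mem_map.2
      (Filter.univ_mem' fun i => Set.mem_range_self i)) subset_closure)
  have hP : Tendsto P U (𝓝 P') := hP'
  have hlim : ∀ A : Fin N → Set W, ∃ L, Tendsto (fun i => l i (Set.univ.pi A)) U (𝓝 L) := by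
    intro A
    obtain ⟨L, -, hL⟩ := isCompact_iff_ultrafilter_le_nhds.1 (isCompact_univ (X := ℝ≥0∞))
      (U.map fun i => l i (Set.univ.pi A)) (by simp)
    exact ⟨L, hL⟩
  have hmarg : ∀ p, (P' : Measure (Fin N → W)).map (fun w => w p) = ν := by
    intro p
    have hc : Continuous fun w : Fin N → W => w p := continuous_apply p
    have h := (ProbabilityMeasure.tendsto_map_of_tendsto_of_continuous P P' hP hc)
    have h2 : ∀ i, (P i).map hc.measurable.aemeasurable = ⟨ν, inferInstance⟩ := by
      intro i
      exact Subtype.ext (hl i p)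
    simp_rw [h2] at h
    have := tendsto_nhds_unique h tendsto_const_nhds
    exact congrArg Subtype.val this
  refine ⟨P', inferInstance, hmarg, fun A hA => ?_⟩
  obtain ⟨L, hL⟩ := hlim A
  convert hL
  -- Weak convergence controls open rectangles from one side and closed ones from the other.
  -- Regularity of `ν` squeezes each side of the rectangle between such sets, at a cost `N * ε`
  -- uniform in `i`.
  apply le_antisymm
  · refine le_of_forall_le_add_mul (N := N) fun ε hε => ?_
    have := fun p => (hA p).exists_isOpen_sdiff_lt (measure_ne_top ν _) hε.ne'
    choose O hAO hO _ hOε using this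
    obtain ⟨LO, hLO⟩ := hlim O
    have h1 : (P' : Measure (Fin N → W)) (Set.univ.pi O) ≤ LO := by
      have := ProbabilityMeasure.le_liminf_measure_open_of_tendsto hP
        (isOpen_set_pi Set.finite_univ fun p _ => hO p)
      exact this.trans_eq hLO.liminf_eq
    have h2 : LO ≤ L + N * ε := le_of_tendsto_of_tendsto' hLO (hL.add tendsto_const_nhds)
      fun i => measure_pi_le_add_of_marginal (hl i) (fun p => (hO p).measurableSet) hA
        fun p => (hOε p).le
    exact (measure_mono (Set.pi_mono fun p _ => hAO p)).trans (h1.trans h2)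
  · refine le_of_forall_le_add_mul (N := N) fun ε hε => ?_
    have := fun p => (hA p).exists_isClosed_sdiff_lt (measure_ne_top ν _) hε.ne'
    choose F hFA hF hFε using this
    obtain ⟨LF, hLF⟩ := hlim F
    have h1 : LF ≤ (P' : Measure (Fin N → W)) (Set.univ.pi F) := by
      have := ProbabilityMeasure.limsup_measure_closed_le_of_tendsto hP
        (isClosed_set_pi (i := Set.univ) fun p _ => hF p)
      exact hLF.limsup_eq.symm.trans_le this
    have h2 : L ≤ LF + N * ε := le_of_tendsto_of_tendsto' hL (hLF.add tendsto_const_nhds)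
      fun i => measure_pi_le_add_of_marginal (hl i) hA (fun p => (hF p).measurableSet)
        fun p => (hFε p).le
    refine h2.trans ?_
    gcongr
    exact h1.trans (measure_mono (Set.pi_mono fun p _ => hFA p))

end Compactness

/-! ### Reduction to ergodic joinings by Krein–Milman. -/

section KreinMilman

theorem MeasureTheory.Measure.ext_of_pi {W : Type*} [MeasurableSpace W] {N : ℕ}
    {l l' : Measure (Fin N → W)} [IsProbabilityMeasure l] [IsProbabilityMeasure l']
    (h : ∀ A : Fin N → Set W, (∀ p, MeasurableSet (A p)) →
      l (Set.univ.pi A) = l' (Set.univ.pi A)) : l = l' := by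
  refine ext_of_generate_finite _ generateFrom_pi.symm isPiSystem_pi ?_ (by simp)
  rintro _ ⟨A, hA, rfl⟩
  exact h A fun p => hA p trivial

/-- The rectangle with sides `B` and `B'` over the coordinates `p` and `q`. -/
def twoFaceRectangle {W : Type*} {N : ℕ} (p q : Fin N) (B B' : Set W) (r : Fin N) : Set W :=
  (if r = p then B else Set.univ) ∩ (if r = q then B' else Set.univ)

theorem measurableSet_twoFaceRectangle {W : Type*} [MeasurableSpace W] {N : ℕ} (p q : Fin N)
    {B B' : Set W} (hB : MeasurableSet B) (hB' : MeasurableSet B') (r : Fin N) :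
    MeasurableSet (twoFaceRectangle p q B B' r) := by
  unfold twoFaceRectangle
  split_ifs <;> measurability

theorem pi_twoFaceRectangle {W : Type*} {N : ℕ} (p q : Fin N) (B B' : Set W) :
    Set.univ.pi (twoFaceRectangle p q B B') = {w | w p ∈ B ∧ w q ∈ B'} := by
  ext w
  simp only [Set.mem_pi, Set.mem_univ, true_implies, twoFaceRectangle, Set.mem_inter_iff,
    Set.mem_ofPred_eq]
  constructor
  · intro h
    have h1 := (h p).1
    have h2 := (h q).2
    simp only [if_true] at h1 h2
    exact ⟨h1, h2⟩
  · rintro ⟨h1, h2⟩ r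
    constructor
    · split_ifs with h
      · rwa [h]
      · trivial
    · split_ifs with h
      · rwa [h]
      · trivial

/-- Expresses a condition on a two-dimensional face through values on rectangles, the form that
passes to limits of couplings. -/
theorem map_face_prod_apply {W V : Type*} [MeasurableSpace W] [MeasurableSpace V] {N : ℕ}
    {f : W → V} (hf : Measurable f) (l : Measure (Fin N → W)) (p q : Fin N) {B B' : Set V}
    (hB : MeasurableSet B) (hB' : MeasurableSet B') :
    l.map (fun w => (f (w p), f (w q))) (B ×ˢ B')
      = l (Set.univ.pi (twoFaceRectangle p q (f ⁻¹' B) (f ⁻¹' B'))) := by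
  rw [Measure.map_apply (by fun_prop) (hB.prod hB'), pi_twoFaceRectangle]
  rfl

theorem map_vadd_map_of_equivariant {G Y Z : Type*} [AddGroup G] [AddAction G Y] [AddAction G Z]
    [MeasurableSpace Y] [MeasurableSpace Z] [MeasurableConstVAdd G Y] [MeasurableConstVAdd G Z]
    {g : Y → Z} (hg : Measurable g) (heq : ∀ (t : G) (y : Y), g (t +ᵥ y) = t +ᵥ g y)
    (l : Measure Y) (t : G) :
    (l.map g).map (fun z => t +ᵥ z) = (l.map fun y => t +ᵥ y).map g := by
  rw [Measure.map_map (measurable_const_vadd t) hg, Measure.map_map hg (measurable_const_vadd t)]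
  congr 1
  ext y
  exact (heq t y).symm

variable {G : Type*} [AddGroup G] {W V : Type*} [AddAction G W] [MeasurableSpace W]
  [MeasurableSpace V]

theorem map_vadd_pi_apply [MeasurableConstVAdd G W] {N : ℕ} (l : Measure (Fin N → W)) (t : G)
    {A : Fin N → Set W} (hA : ∀ p, MeasurableSet (A p)) :
    l.map (fun w => t +ᵥ w) (Set.univ.pi A)
      = l (Set.univ.pi fun p => (fun x => t +ᵥ x) ⁻¹' (A p)) := by
  rw [Measure.map_apply (measurable_const_vadd t)
    (MeasurableSet.univ_pi hA)]
  rfl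

/-- Self-joinings of `ν` whose projections to two-dimensional faces, after applying `f` to each
coordinate, are equal to `σ`. -/
def selfJoiningsWithFaces (G : Type*) [AddGroup G] {W V : Type*} [AddAction G W]
    [MeasurableSpace W] [MeasurableSpace V] (ν : Measure W) (N : ℕ) (f : W → V)
    (σ : Measure (V × V)) : Set (Measure (Fin N → W)) :=
  {l | IsSelfJoining G ν N l ∧ ∀ p q, p < q → l.map (fun w => (f (w p), f (w q))) = σ}

/-- The values of a measure on measurable rectangles. -/
noncomputable def rectangleValues {W : Type*} [MeasurableSpace W] {N : ℕ}
    (l : Measure (Fin N → W)) (A : {A : Fin N → Set W // ∀ p, MeasurableSet (A p)}) : ℝ :=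
  l.real (Set.univ.pi A.1)

theorem rectangleValues_injective {N : ℕ} {l l' : Measure (Fin N → W)} [IsProbabilityMeasure l]
    [IsProbabilityMeasure l'] (h : rectangleValues l = rectangleValues l') : l = l' := by
  refine Measure.ext_of_pi fun A hA => ?_
  exact (measureReal_eq_measureReal_iff).1 (congrFun h ⟨A, hA⟩)

variable {ν : Measure W} {N : ℕ} {f : W → V} {σ : Measure (V × V)}

/-- Invariance and the conditions on faces are equalities between values on rectangles, so they
survive the limit along an ultrafilter. -/
theorem isCompact_rectangleValues [IsProbabilityMeasure ν] [MeasurableConstVAdd G W] [StandardBorelSpace W]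
    (hf : Measurable f) :
    IsCompact (rectangleValues '' selfJoiningsWithFaces G ν N f σ) := by
  rw [isCompact_iff_ultrafilter_le_nhds]
  intro U hU
  have hU' : rectangleValues '' selfJoiningsWithFaces G ν N f σ ∈ U := by simpa using hU
  have hne : (selfJoiningsWithFaces G ν N f σ).Nonempty :=
    Set.image_nonempty.1 (U.neBot.nonempty_of_mem hU')
  obtain ⟨l₀, hl₀⟩ := hne
  -- A joining is chosen for every point of the ambient space, with the dummy `l₀` off the image, so
  -- that `U` itself can serve as the ultrafilter on indices.
  have hch : ∀ z : {A : Fin N → Set W // ∀ p, MeasurableSet (A p)} → ℝ,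
      ∃ l ∈ selfJoiningsWithFaces G ν N f σ,
        z ∈ rectangleValues '' selfJoiningsWithFaces G ν N f σ → rectangleValues l = z := by
    intro z
    by_cases hz : z ∈ rectangleValues '' selfJoiningsWithFaces G ν N f σ
    · obtain ⟨l, hl, rfl⟩ := hz
      exact ⟨l, hl, fun _ => rfl⟩
    · exact ⟨l₀, hl₀, fun h => absurd h hz⟩
  choose l hl hlz using hch
  obtain ⟨l', hl'prob, hl'marg, hl'⟩ := exists_tendsto_measure_pi_of_marginal (ν := ν) U
    (fun z => (hl z).1.isProbabilityMeasure) fun z p => (hl z).1.marginal p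
  have hconst : ∀ {A A' : Fin N → Set W}, (∀ p, MeasurableSet (A p)) →
      (∀ p, MeasurableSet (A' p)) → (∀ z, l z (Set.univ.pi A) = l z (Set.univ.pi A')) →
      l' (Set.univ.pi A) = l' (Set.univ.pi A') := by
    intro A A' hA hA' h
    exact tendsto_nhds_unique (hl' A hA) ((hl' A' hA').congr fun z => (h z).symm)
  have hl'C : l' ∈ selfJoiningsWithFaces G ν N f σ := by
    refine ⟨⟨hl'prob, fun t => ⟨measurable_const_vadd t, ?_⟩, hl'marg⟩, fun p q hpq => ?_⟩
    · have : IsProbabilityMeasure (l'.map fun w : Fin N → W => t +ᵥ w) :=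
        Measure.isProbabilityMeasure_map (measurable_const_vadd t).aemeasurable
      refine Measure.ext_of_pi fun A hA => ?_
      rw [map_vadd_pi_apply l' t hA]
      refine hconst (fun p => measurable_const_vadd t (hA p)) hA fun z => ?_
      rw [← map_vadd_pi_apply (l z) t hA, ((hl z).1.invariant t).map_eq]
    · have : IsProbabilityMeasure (l'.map fun w => (f (w p), f (w q))) :=
        Measure.isProbabilityMeasure_map (by fun_prop)
      refine Measure.ext_prod fun {B B'} hB hB' => ?_
      rw [map_face_prod_apply hf _ _ _ hB hB']
      have h := hl' _ (measurableSet_twoFaceRectangle p q (hf hB) (hf hB'))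
      refine tendsto_nhds_unique h (tendsto_const_nhds.congr fun z => ?_)
      rw [← map_face_prod_apply hf _ _ _ hB hB', (hl z).2 p q hpq]
  refine ⟨_, ⟨l', hl'C, rfl⟩, ?_⟩
  change Tendsto id (U : Filter ({A : Fin N → Set W // ∀ p, MeasurableSet (A p)} → ℝ)) _
  rw [tendsto_pi_nhds]
  intro A
  have h := (ENNReal.tendsto_toReal (measure_ne_top l' (Set.univ.pi A.1))).comp (hl' A.1 A.2)
  refine Tendsto.congr' ?_ h
  filter_upwards [hU'] with z hz
  exact congrFun (hlz z hz) A

theorem convex_rectangleValues [MeasurableConstVAdd G W] (hf : Measurable f) :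
    Convex ℝ (rectangleValues '' selfJoiningsWithFaces G ν N f σ) := by
  rintro _ ⟨l₁, h₁, rfl⟩ _ ⟨l₂, h₂, rfl⟩ a b ha hb hab
  have := h₁.1.isProbabilityMeasure
  have := h₂.1.isProbabilityMeasure
  have hab' : ENNReal.ofReal a + ENNReal.ofReal b = 1 := by
    rw [← ENNReal.ofReal_add ha hb, hab, ENNReal.ofReal_one]
  refine ⟨ENNReal.ofReal a • l₁ + ENNReal.ofReal b • l₂, ⟨⟨⟨by simp [hab']⟩, fun t =>
    ⟨measurable_const_vadd t, ?_⟩, fun p => ?_⟩, fun p q hpq => ?_⟩, ?_⟩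
  · rw [Measure.map_add _ _ (measurable_const_vadd t), Measure.map_smul, Measure.map_smul,
      (h₁.1.invariant t).map_eq, (h₂.1.invariant t).map_eq]
  · rw [Measure.map_add _ _ (measurable_pi_apply p), Measure.map_smul, Measure.map_smul,
      h₁.1.marginal, h₂.1.marginal, ← add_smul, hab', one_smul]
  · rw [Measure.map_add _ _ (by fun_prop), Measure.map_smul, Measure.map_smul,
      h₁.2 p q hpq, h₂.2 p q hpq, ← add_smul, hab', one_smul]
  · ext A
    simp [rectangleValues, measureReal_def, ENNReal.toReal_add, ENNReal.mul_ne_top,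
      ENNReal.toReal_ofReal, ha, hb]

/-- Conditioning on an invariant set gives an invariant measure absolutely continuous with respect
to `l`. Its marginals and faces are therefore invariant and absolutely continuous with respect to
the ergodic `ν` and `σ`, hence equal to them. -/
theorem cond_mem_selfJoiningsWithFaces [AddAction G V]
    [IsProbabilityMeasure ν] [IsProbabilityMeasure σ] [MeasurableConstVAdd G W] [MeasurableConstVAdd G V]
    (hf : Measurable f) (heq : ∀ (t : G) (w : W), f (t +ᵥ w) = t +ᵥ f w)
    (hν : ErgodicVAdd G W ν) (hσ : ErgodicVAdd G (V × V) σ) {l : Measure (Fin N → W)}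
    (hl : l ∈ selfJoiningsWithFaces G ν N f σ) {E : Set (Fin N → W)} (hE : MeasurableSet E)
    (hinv : ∀ t : G, (t +ᵥ ·) ⁻¹' E =ᵐ[l] E) (hE0 : l E ≠ 0) :
    ProbabilityTheory.cond l E ∈ selfJoiningsWithFaces G ν N f σ := by
  have := hl.1.isProbabilityMeasure
  have hprob : IsProbabilityMeasure (ProbabilityTheory.cond l E) :=
    ProbabilityTheory.cond_isProbabilityMeasure hE0
  have hac : ProbabilityTheory.cond l E ≪ l := ProbabilityTheory.cond_absolutelyContinuous
  have hpres : ∀ t : G, (ProbabilityTheory.cond l E).map (fun w => t +ᵥ w)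
      = ProbabilityTheory.cond l E := by
    intro t
    ext s hs
    rw [Measure.map_apply (measurable_const_vadd t) hs, ProbabilityTheory.cond_apply hE,
      ProbabilityTheory.cond_apply hE,
      ← (hl.1.invariant t).measure_preimage (hE.inter hs).nullMeasurableSet, Set.preimage_inter]
    congr 1
    exact measure_congr ((hinv t).symm.inter (ae_eq_refl _))
  refine ⟨⟨hprob, fun t => ⟨measurable_const_vadd t, hpres t⟩, fun p => ?_⟩, fun p q hpq => ?_⟩
  · have : IsProbabilityMeasure ((ProbabilityTheory.cond l E).map fun w => w p) :=
      Measure.isProbabilityMeasure_map (measurable_pi_apply p).aemeasurable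
    refine hν.eq_of_absolutelyContinuous ?_ fun t => ?_
    · rw [← hl.1.marginal p]
      exact hac.map (measurable_pi_apply p)
    · nth_rw 2 [← hpres t]
      exact map_vadd_map_of_equivariant (g := fun w : Fin N → W => w p) (measurable_pi_apply p)
        (fun _ _ => rfl) _ t
  · have hm : Measurable fun w : Fin N → W => (f (w p), f (w q)) := by fun_prop
    have : IsProbabilityMeasure ((ProbabilityTheory.cond l E).map fun w => (f (w p), f (w q))) :=
      Measure.isProbabilityMeasure_map hm.aemeasurable
    refine hσ.eq_of_absolutelyContinuous ?_ fun t => ?_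
    · rw [← hl.2 p q hpq]
      exact hac.map hm
    · nth_rw 2 [← hpres t]
      exact map_vadd_map_of_equivariant hm (fun t w => by simp [heq]) _ t

theorem ergodicVAdd_of_mem_extremePoints [AddAction G V]
    [IsProbabilityMeasure ν] [IsProbabilityMeasure σ] [MeasurableConstVAdd G W] [MeasurableConstVAdd G V]
    (hf : Measurable f) (heq : ∀ (t : G) (w : W), f (t +ᵥ w) = t +ᵥ f w)
    (hν : ErgodicVAdd G W ν) (hσ : ErgodicVAdd G (V × V) σ) {l : Measure (Fin N → W)}
    (hl : l ∈ selfJoiningsWithFaces G ν N f σ)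
    (hext : rectangleValues l ∈ (rectangleValues '' selfJoiningsWithFaces G ν N f σ).extremePoints ℝ) :
    ErgodicVAdd G (Fin N → W) l := by
  have := hl.1.isProbabilityMeasure
  refine { measure_preimage_vadd := fun t s hs =>
             (hl.1.invariant t).measure_preimage hs.nullMeasurableSet,
           aeconst_of_forall_preimage_vadd_ae_eq := fun {E} hE hinv => ?_ }
  rw [eventuallyConst_set]
  by_contra! hcon
  have h1 : l E ≠ 0 := fun h => hcon.2 (measure_eq_zero_iff_ae_notMem.1 h)
  have h2 : l Eᶜ ≠ 0 := fun h => hcon.1 (by simpa using mem_ae_iff.2 h)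
  have hC1 := cond_mem_selfJoiningsWithFaces hf heq hν hσ hl hE hinv h1
  have hC2 := cond_mem_selfJoiningsWithFaces hf heq hν hσ hl hE.compl
    (fun t => (hinv t).compl) h2
  have := hC1.1.isProbabilityMeasure
  -- The measure `l` is the mixture of its conditionings on `E` and `Eᶜ`; extremality then makes the
  -- first of them equal to `l`, contradicting `l Eᶜ ≠ 0`.
  have hseg : rectangleValues l ∈ openSegment ℝ (rectangleValues (ProbabilityTheory.cond l E))
      (rectangleValues (ProbabilityTheory.cond l Eᶜ)) := by
    refine ⟨l.real E, l.real Eᶜ, ENNReal.toReal_pos h1 (measure_ne_top _ _),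
      ENNReal.toReal_pos h2 (measure_ne_top _ _), ?_, ?_⟩
    · rw [measureReal_add_measureReal_compl hE]
      simp
    · ext A
      have hA := MeasurableSet.univ_pi A.2
      have e1 : l.real E ≠ 0 := (ENNReal.toReal_pos h1 (measure_ne_top _ _)).ne'
      have e2 : l.real Eᶜ ≠ 0 := (ENNReal.toReal_pos h2 (measure_ne_top _ _)).ne'
      simp only [rectangleValues, Pi.add_apply, Pi.smul_apply, smul_eq_mul]
      rw [measureReal_def (μ := ProbabilityTheory.cond l E),
        measureReal_def (μ := ProbabilityTheory.cond l Eᶜ),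
        ProbabilityTheory.cond_apply hE, ProbabilityTheory.cond_apply hE.compl,
        ENNReal.toReal_mul, ENNReal.toReal_mul, ENNReal.toReal_inv, ENNReal.toReal_inv]
      change l.real E * ((l.real E)⁻¹ * l.real _) + l.real Eᶜ * ((l.real Eᶜ)⁻¹ * l.real _) = _
      rw [mul_inv_cancel_left₀ e1, mul_inv_cancel_left₀ e2, Set.inter_comm E, Set.inter_comm Eᶜ,
        ← Set.sdiff_eq, measureReal_inter_add_sdiff hE]
  have h := (mem_extremePoints.1 hext).2 _ ⟨_, hC1, rfl⟩ _ ⟨_, hC2, rfl⟩ hseg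
  have hE1 : ProbabilityTheory.cond l E = l := rectangleValues_injective h.1
  apply h2
  rw [← hE1, ProbabilityTheory.cond_apply hE]
  simp

/-- If all ergodic self-joinings with prescribed ergodic two-dimensional faces give the same value
to a rectangle, then so do all self-joinings with these faces. -/
theorem measure_pi_eq_of_forall_ergodic [AddAction G V]
    [IsProbabilityMeasure ν] [IsProbabilityMeasure σ] [MeasurableConstVAdd G W] [MeasurableConstVAdd G V]
    [StandardBorelSpace W]
    (hf : Measurable f) (heq : ∀ (t : G) (w : W), f (t +ᵥ w) = t +ᵥ f w)
    (hν : ErgodicVAdd G W ν) (hσ : ErgodicVAdd G (V × V) σ) {A : Fin N → Set W}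
    (hA : ∀ p, MeasurableSet (A p)) {c : ℝ}
    (h : ∀ l ∈ selfJoiningsWithFaces G ν N f σ, ErgodicVAdd G (Fin N → W) l →
      l.real (Set.univ.pi A) = c) {l : Measure (Fin N → W)}
    (hl : l ∈ selfJoiningsWithFaces G ν N f σ) : l.real (Set.univ.pi A) = c := by
  have hKM := closure_convexHull_extremePoints
    (isCompact_rectangleValues (G := G) (ν := ν) (N := N) (σ := σ) hf)
    (convex_rectangleValues (G := G) (ν := ν) (N := N) (σ := σ) hf)
  -- Prescribing one coordinate cuts out a closed convex set; it contains the extreme points, hence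
  -- everything.
  have hsub : closure (convexHull ℝ
      ((rectangleValues '' selfJoiningsWithFaces G ν N f σ).extremePoints ℝ))
      ⊆ {z | z ⟨A, hA⟩ = c} := by
    refine closure_minimal (convexHull_min ?_ ?_)
      (isClosed_eq (continuous_apply _) continuous_const)
    · intro z hz
      obtain ⟨l, hl, rfl⟩ := hz.1
      exact h l hl (ergodicVAdd_of_mem_extremePoints hf heq hν hσ hl hz)
    · intro z hz z' hz' a b _ _ hab
      simp only [Set.mem_ofPred_eq] at hz hz'
      simp only [Set.mem_ofPred_eq, Pi.add_apply, Pi.smul_apply, smul_eq_mul, hz, hz']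
      rw [← add_mul, hab, one_mul]
  exact hsub (hKM.symm ▸ ⟨l, hl, rfl⟩ : rectangleValues l ∈ _)

end KreinMilman

/-! ### Relatively independent self-joinings over a graph. -/

section RelativeProduct

open ProbabilityTheory

variable {X U : Type*} [MeasurableSpace X] [MeasurableSpace U]

/-- The law of `((x, u), (x', τ u))`, where `u` has law `ρ` and, given `u`, the points `x` and `x'`
are independent with laws `κ u` and `κ (τ u)`. -/
noncomputable def shiftedRelativeProduct (ρ : Measure U) (κ : Kernel U X) {τ : U → U}
    (hτ : Measurable τ) : Measure (Fin 2 → X × U) :=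
  (ρ.compProd (κ ×ₖ κ.comap τ hτ)).map fun q => ![(q.2.1, q.1), (q.2.2, τ q.1)]

variable {ρ : Measure U} [IsProbabilityMeasure ρ] {κ : Kernel U X} [IsMarkovKernel κ]
  {τ : U → U} {hτ : Measurable τ}

theorem measurable_shiftedPair (hτ : Measurable τ) :
    Measurable fun q : U × X × X => (![(q.2.1, q.1), (q.2.2, τ q.1)] : Fin 2 → X × U) := by
  refine measurable_pi_iff.2 fun i => ?_
  fin_cases i
  · change Measurable fun q : U × X × X => (q.2.1, q.1)
    fun_prop
  · change Measurable fun q : U × X × X => (q.2.2, τ q.1)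
    fun_prop

theorem shiftedRelativeProduct_apply {E : Set (Fin 2 → X × U)} (hE : MeasurableSet E) :
    shiftedRelativeProduct ρ κ hτ E
      = ∫⁻ u, ((κ u).prod (κ (τ u))) {p | ![(p.1, u), (p.2, τ u)] ∈ E} ∂ρ := by
  rw [shiftedRelativeProduct, Measure.map_apply (measurable_shiftedPair hτ) hE,
    Measure.compProd_apply (measurable_shiftedPair hτ hE)]
  refine lintegral_congr fun u => ?_
  rw [Kernel.prod_apply, Kernel.comap_apply]
  rfl

instance : IsProbabilityMeasure (shiftedRelativeProduct ρ κ hτ) :=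
  Measure.isProbabilityMeasure_map (measurable_shiftedPair hτ).aemeasurable

theorem map_zero_shiftedRelativeProduct {ν : Measure (X × U)}
    (hκ : ρ.compProd κ = ν.map Prod.swap) :
    (shiftedRelativeProduct ρ κ hτ).map (fun w => w 0) = ν := by
  ext E hE
  rw [Measure.map_apply (measurable_pi_apply 0) hE,
    shiftedRelativeProduct_apply (measurable_pi_apply 0 hE)]
  have h1 : ν E = (ν.map Prod.swap) (Prod.swap ⁻¹' E) := by
    rw [Measure.map_apply measurable_swap (measurable_swap hE)]
    rfl
  rw [h1, ← hκ, Measure.compProd_apply (measurable_swap hE)]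
  refine lintegral_congr fun u => ?_
  have h2 : {p : X × X | ![(p.1, u), (p.2, τ u)] ∈ (fun w : Fin 2 → X × U => w 0) ⁻¹' E}
      = {x | (x, u) ∈ E} ×ˢ Set.univ := by
    ext p
    simp
  rw [h2, Measure.prod_prod]
  simp
  rfl

theorem map_one_shiftedRelativeProduct {ν : Measure (X × U)}
    (hκ : ρ.compProd κ = ν.map Prod.swap) (hτρ : MeasurePreserving τ ρ ρ) :
    (shiftedRelativeProduct ρ κ hτ).map (fun w => w 1) = ν := by
  ext E hE
  rw [Measure.map_apply (measurable_pi_apply 1) hE,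
    shiftedRelativeProduct_apply (measurable_pi_apply 1 hE)]
  have h1 : ν E = (ν.map Prod.swap) (Prod.swap ⁻¹' E) := by
    rw [Measure.map_apply measurable_swap (measurable_swap hE)]
    rfl
  rw [h1, ← hκ, Measure.compProd_apply (measurable_swap hE), ← hτρ.lintegral_comp
    (Kernel.measurable_kernel_prodMk_left (measurable_swap hE))]
  refine lintegral_congr fun u => ?_
  have h2 : {p : X × X | ![(p.1, u), (p.2, τ u)] ∈ (fun w : Fin 2 → X × U => w 1) ⁻¹' E}
      = Set.univ ×ˢ {x | (x, τ u) ∈ E} := by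
    ext p
    simp
  rw [h2, Measure.prod_prod]
  simp
  rfl

theorem map_snd_shiftedRelativeProduct :
    (shiftedRelativeProduct ρ κ hτ).map (fun w => ((w 0).2, (w 1).2))
      = ρ.map fun u => (u, τ u) := by
  rw [shiftedRelativeProduct, Measure.map_map (by fun_prop) (measurable_shiftedPair hτ)]
  conv_rhs => rw [← Measure.fst_compProd ρ (κ ×ₖ κ.comap τ hτ), Measure.fst,
    Measure.map_map (by fun_prop) measurable_fst]
  rfl

theorem shiftedRelativeProduct_rectangle {A A' : Set X} (hA : MeasurableSet A)
    (hA' : MeasurableSet A') :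
    shiftedRelativeProduct ρ κ hτ (Set.univ.pi ![A ×ˢ Set.univ, A' ×ˢ Set.univ])
      = ∫⁻ u, κ u A * κ (τ u) A' ∂ρ := by
  rw [shiftedRelativeProduct_apply]
  · refine lintegral_congr fun u => ?_
    rw [← Measure.prod_prod]
    congr 1
    ext p
    simp [Set.mem_pi, Fin.forall_fin_two]
  · refine MeasurableSet.univ_pi fun i => ?_
    fin_cases i
    · exact hA.prod .univ
    · exact hA'.prod .univ

variable {G : Type*} [AddGroup G] [AddAction G X] [AddAction G U] [MeasurableConstVAdd G X]
  [MeasurableConstVAdd G U]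

/-- The disintegration of an invariant measure is equivariant. -/
theorem ae_kernel_map_vadd_eq [StandardBorelSpace X] {ν : Measure (X × U)}
    (hκ : ρ.compProd κ = ν.map Prod.swap) (hρ : ∀ t : G, ρ.map (fun u => t +ᵥ u) = ρ)
    (hν : ∀ t : G, ν.map (fun w => t +ᵥ w) = ν) (t : G) :
    ∀ᵐ u ∂ρ, (κ u).map (fun x => t +ᵥ x) = κ (t +ᵥ u) := by
  have hρne : Nonempty U := nonempty_of_isProbabilityMeasure ρ
  have hX : Nonempty X := nonempty_of_isProbabilityMeasure (κ hρne.some)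
  have hpres : ∀ t : G, MeasurePreserving (fun u => t +ᵥ u) ρ ρ :=
    fun t => ⟨measurable_const_vadd t, hρ t⟩
  -- The kernel transported by `t` disintegrates the same invariant measure, so it equals `κ` almost
  -- everywhere by uniqueness.
  let κ' : Kernel U X := (κ.comap (fun u => -t +ᵥ u) (measurable_const_vadd (-t))).map
    (fun x => t +ᵥ x)
  have hmt : Measurable fun x : X => t +ᵥ x := measurable_const_vadd t
  have hκ'apply : ∀ u, κ' u = (κ (-t +ᵥ u)).map (fun x => t +ᵥ x) := by
    intro u
    rw [Kernel.map_apply _ hmt, Kernel.comap_apply]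
  have hκ'm : IsMarkovKernel κ' := Kernel.IsMarkovKernel.map _ hmt
  have hνs : (ν.map Prod.swap).map (fun w => t +ᵥ w) = ν.map Prod.swap := by
    rw [map_vadd_map_of_equivariant measurable_swap (fun _ _ => rfl), hν]
  have hκ' : ρ.compProd κ' = ν.map Prod.swap := by
    ext E hE
    rw [Measure.compProd_apply hE, ← (hpres t).lintegral_comp
      (Kernel.measurable_kernel_prodMk_left hE), ← hνs, ← hκ,
      Measure.map_apply (measurable_const_vadd t) hE,
      Measure.compProd_apply (measurable_const_vadd t hE)]
    refine lintegral_congr fun u => ?_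
    rw [hκ'apply, neg_vadd_vadd, Measure.map_apply hmt (measurable_prodMk_left hE)]
    rfl
  have hfin : IsFiniteMeasure (ν.map Prod.swap) := by
    rw [← hκ]
    infer_instance
  have hfst : (ν.map Prod.swap).fst = ρ := by rw [← hκ, Measure.fst_compProd]
  have h1 := eq_condKernel_of_measure_eq_compProd (ρ := ν.map Prod.swap) κ (by rw [hfst, hκ])
  have h2 := eq_condKernel_of_measure_eq_compProd (ρ := ν.map Prod.swap) κ' (by rw [hfst, hκ'])
  rw [hfst] at h1 h2
  have h3 : ∀ᵐ u ∂ρ, κ' u = κ u := by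
    filter_upwards [h1, h2] with u e1 e2
    rw [e1, e2]
  filter_upwards [(hpres t).quasiMeasurePreserving.ae h3] with u hu
  rw [← hu, hκ'apply, neg_vadd_vadd]

/-- Equivariance of `κ` is used at `u` and at `τ u`; since `τ` commutes with the action, the
substitution `u ↦ t + u` moves both fibres consistently. -/
theorem map_vadd_shiftedRelativeProduct [StandardBorelSpace X] {ν : Measure (X × U)}
    (hκ : ρ.compProd κ = ν.map Prod.swap) (hρ : ∀ t : G, ρ.map (fun u => t +ᵥ u) = ρ)
    (hν : ∀ t : G, ν.map (fun w => t +ᵥ w) = ν) (hτρ : MeasurePreserving τ ρ ρ)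
    (hτG : ∀ (t : G) (u : U), τ (t +ᵥ u) = t +ᵥ τ u) (t : G) :
    (shiftedRelativeProduct ρ κ hτ).map (fun w => t +ᵥ w) = shiftedRelativeProduct ρ κ hτ := by
  have hae := ae_kernel_map_vadd_eq hκ hρ hν t
  have hmt : Measurable fun x : X => t +ᵥ x := measurable_const_vadd t
  ext E hE
  rw [Measure.map_apply (measurable_const_vadd t) hE,
    shiftedRelativeProduct_apply (measurable_const_vadd t hE), shiftedRelativeProduct_apply hE]
  have hmeas : Measurable fun u =>
      ((κ u).prod (κ (τ u))) {p | ![(p.1, u), (p.2, τ u)] ∈ E} := by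
    have := Kernel.measurable_kernel_prodMk_left (κ := κ ×ₖ κ.comap τ hτ)
      (measurable_shiftedPair hτ hE)
    simp_rw [Kernel.prod_apply, Kernel.comap_apply] at this
    exact this
  have hpres : MeasurePreserving (fun u => t +ᵥ u) ρ ρ := ⟨measurable_const_vadd t, hρ t⟩
  conv_rhs => rw [← hpres.lintegral_comp hmeas]
  refine lintegral_congr_ae ?_
  filter_upwards [hae, hτρ.quasiMeasurePreserving.ae hae] with u h1 h2
  have hsec : MeasurableSet {p : X × X | ![(p.1, t +ᵥ u), (p.2, τ (t +ᵥ u))] ∈ E} :=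
    measurable_prodMk_left (measurable_shiftedPair hτ hE)
  rw [← h1, hτG, ← h2, Measure.map_prod_map _ _ hmt hmt,
    Measure.map_apply (hmt.prodMap hmt) (by rwa [hτG] at hsec)]
  congr 1
  ext p
  simp only [Set.mem_preimage, Set.mem_ofPred_eq, Prod.map]
  have : (t +ᵥ (![(p.1, u), (p.2, τ u)] : Fin 2 → X × U))
      = ![(t +ᵥ p.1, t +ᵥ u), (t +ᵥ p.2, t +ᵥ τ u)] := by
    ext i <;> fin_cases i <;> rfl
  rw [this]

end RelativeProduct

/-! ### Joinings of two copies of the flow with a third system. -/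

section TripleStep

open ProbabilityTheory

/-- Moving the first coordinate of a product by a small element of the flow changes bounded
functions little. -/
theorem IsFlow.tendsto_integral_mul_shift {G : Type*} [AddGroup G] [TopologicalSpace G]
    [FirstCountableTopology G] {X Z : Type*} [AddAction G X] [MeasurableSpace X]
    [MeasurableSpace Z] [MeasurableConstVAdd G X] {μ : Measure X} [IsProbabilityMeasure μ]
    {ρ : Measure Z} [IsProbabilityMeasure ρ] (hT : IsFlow G μ) {φ : X × Z → ℝ}
    (hφ : Measurable φ) (h0 : ∀ u, 0 ≤ φ u) (h1 : ∀ u, φ u ≤ 1) :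
    Tendsto (fun s : G => ∫ u, φ u * φ (s +ᵥ u.1, u.2) ∂(μ.prod ρ)) (𝓝 0)
      (𝓝 (∫ u, φ u * φ u ∂(μ.prod ρ))) := by
  have hsm : ∀ s : G, Measurable fun u : X × Z => φ (s +ᵥ u.1, u.2) := fun s =>
    hφ.comp (((measurable_const_vadd s).comp measurable_fst).prodMk measurable_snd)
  have hle : ∀ u v, ‖φ u * φ v‖ ≤ 1 := fun u v => by
    rw [Real.norm_of_nonneg (mul_nonneg (h0 u) (h0 v))]
    exact mul_le_one₀ (h1 u) (h0 v) (h1 v)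
  have hfub : ∀ s : G, ∫ u, φ u * φ (s +ᵥ u.1, u.2) ∂(μ.prod ρ)
      = ∫ z, ∫ y, φ (y, z) * φ (s +ᵥ y, z) ∂μ ∂ρ := fun s =>
    integral_prod_symm _ (Integrable.of_bound (hφ.mul (hsm s)).aestronglyMeasurable 1
      (ae_of_all _ fun u => hle _ _))
  have hfub0 : ∫ u, φ u * φ u ∂(μ.prod ρ) = ∫ z, ∫ y, φ (y, z) * φ (y, z) ∂μ ∂ρ :=
    integral_prod_symm _ (Integrable.of_bound (hφ.mul hφ).aestronglyMeasurable 1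
      (ae_of_all _ fun u => hle _ _))
  simp_rw [hfub, hfub0]
  -- After Fubini, continuity of the flow applies to each section `y ↦ φ (y, z)`; the bound `1`
  -- allows integration of the limit over `z`.
  refine tendsto_integral_filter_of_dominated_convergence (fun _ => 1) ?_ ?_
    (integrable_const _) ?_
  · refine Eventually.of_forall fun s => ?_
    exact ((hφ.mul (hsm s)).stronglyMeasurable.integral_prod_left').aestronglyMeasurable
  · refine Eventually.of_forall fun s => ae_of_all _ fun z => ?_
    calc ‖∫ y, φ (y, z) * φ (s +ᵥ y, z) ∂μ‖ ≤ 1 * μ.real Set.univ :=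
          norm_integral_le_of_norm_le_const (ae_of_all _ fun y => hle _ _)
      _ = 1 := by simp
  · refine ae_of_all _ fun z => ?_
    have hmem : MemLp (fun y => φ (y, z)) 2 μ :=
      MemLp.of_bound (hφ.comp measurable_prodMk_right).aestronglyMeasurable 1
        (ae_of_all _ fun y => by rw [Real.norm_of_nonneg (h0 _)]; exact h1 _)
    simpa only [mul_comm] using hT.continuous _ _ hmem hmem

theorem ae_eq_of_map_eq_diagonalShift {Y X : Type*} [MeasurableSpace Y] [MeasurableSpace X]
    [StandardBorelSpace X] {l : Measure Y} {μ : Measure X} {g g' : Y → X} (hg : Measurable g)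
    (hg' : Measurable g') {S : X → X} (hS : Measurable S)
    (h : l.map (fun w => (g w, g' w)) = diagonalShift μ S) : ∀ᵐ w ∂l, g' w = S (g w) := by
  have hset : MeasurableSet {p : X × X | p.2 = S p.1} :=
    measurableSet_eq_fun measurable_snd (hS.comp measurable_fst)
  refine ae_of_ae_map (f := fun w => (g w, g' w)) (p := fun p => p.2 = S p.1)
    (hg.prodMk hg').aemeasurable ?_
  rw [h, diagonalShift, ae_map_iff (f := fun x => (x, S x)) (by fun_prop) hset]
  exact ae_of_all _ fun x => rfl

/-- The mean of `κ u A` is `μ A`. If the second moment were always `μ(A)²`, the variance would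
vanish, so `κ u A = μ A` almost everywhere for each `A`, and `ν` would be the product. -/
theorem exists_integral_sq_ne_of_ne_prod {X U : Type*} [MeasurableSpace X]
    [MeasurableSpace U] {μ : Measure X} [IsProbabilityMeasure μ] {η : Measure U}
    [IsProbabilityMeasure η] {κ : Kernel U X} [IsMarkovKernel κ]
    {ν : Measure (X × U)} (hκ : η.compProd κ = ν.map Prod.swap) (hνμ : ν.map Prod.fst = μ) (hne : ν ≠ μ.prod η) :
    ∃ A, MeasurableSet A ∧ ∫ u, (κ u).real A * (κ u).real A ∂η ≠ μ.real A * μ.real A := by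
  by_contra! hcon
  apply hne
  have hval : ∀ A D, MeasurableSet A → MeasurableSet D → ν (A ×ˢ D) = ∫⁻ u in D, κ u A ∂η := by
    intro A D hA hD
    have h1 : ν (A ×ˢ D) = (ν.map Prod.swap) (D ×ˢ A) := by
      rw [Measure.map_apply measurable_swap (hD.prod hA), Set.preimage_swap_prod]
    rw [h1, ← hκ, Measure.compProd_apply_prod hD hA]
  symm
  refine Measure.prod_eq fun A D hA hD => ?_
  have hmeas : Measurable fun u => (κ u).real A := (κ.measurable_coe hA).ennreal_toReal
  have hint : Integrable (fun u => (κ u).real A) η :=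
    Integrable.of_bound hmeas.aestronglyMeasurable 1 (ae_of_all _ fun u => by
      rw [Real.norm_of_nonneg measureReal_nonneg]
      exact measureReal_le_one)
  have hint2 : Integrable (fun u => (κ u).real A * (κ u).real A) η :=
    Integrable.of_bound (hmeas.mul hmeas).aestronglyMeasurable 1 (ae_of_all _ fun u => by
      rw [Real.norm_of_nonneg (by positivity)]
      exact mul_le_one₀ measureReal_le_one measureReal_nonneg measureReal_le_one)
  have hmean : ∫ u, (κ u).real A ∂η = μ.real A := by
    have h := hval A Set.univ hA .univ
    rw [Measure.restrict_univ] at h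
    rw [measureReal_def, ← hνμ, Measure.map_apply measurable_fst hA, ← Set.prod_univ, h]
    exact integral_toReal (κ.measurable_coe hA).aemeasurable
      (ae_of_all _ fun u => measure_lt_top _ _)
  have hvar : ∫ u, ((κ u).real A - μ.real A) ^ 2 ∂η = 0 := by
    have e : ∀ u, ((κ u).real A - μ.real A) ^ 2 = (κ u).real A * (κ u).real A
        - (2 * μ.real A * (κ u).real A - μ.real A * μ.real A) := fun u => by ring
    simp_rw [e]
    rw [integral_sub (g := fun u => 2 * μ.real A * (κ u).real A - μ.real A * μ.real A) hint2
      ((hint.const_mul _).sub (integrable_const _)), integral_sub (hint.const_mul _) (integrable_const _), integral_const_mul, hcon A hA, hmean]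
    simp
    ring
  have hint3 : Integrable (fun u => ((κ u).real A - μ.real A) ^ 2) η := by
    have e : (fun u => ((κ u).real A - μ.real A) ^ 2) = fun u => (κ u).real A * (κ u).real A
        - (2 * μ.real A * (κ u).real A - μ.real A * μ.real A) := by ext u; ring
    rw [e]
    exact hint2.sub ((hint.const_mul _).sub (integrable_const _))
  have hae : ∀ᵐ u ∂η, κ u A = μ A := by
    filter_upwards [(integral_eq_zero_iff_of_nonneg (fun u => sq_nonneg _) hint3).1 hvar]
      with u hu
    exact (measureReal_eq_measureReal_iff).1 (sub_eq_zero.1 (pow_eq_zero_iff two_ne_zero |>.1 hu))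
  rw [hval A D hA hD, lintegral_congr_ae (ae_restrict_of_ae hae)]
  simp

variable {G : Type*} [AddCommGroup G] {X Z : Type*} [AddAction G X]
  [MeasurableSpace X] [StandardBorelSpace X] [MeasurableConstVAdd G X] {μ : Measure X}
  [IsProbabilityMeasure μ]

/-- In a 2-simple action, an ergodic self-joining of order two whose first coordinates are not
independent and whose second coordinates are related by `τ` produces a symmetry. -/
theorem IsSimpleOfOrder.exists_map_eq_of_ergodic {U : Type*} [MeasurableSpace U]
    [StandardBorelSpace U] [AddAction G U] [MeasurableConstVAdd G U]
    (hsimple : IsSimpleOfOrder G μ 2) {ν : Measure (X × U)} (hνμ : ν.map Prod.fst = μ)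
    {ρ : Measure U} {τ : U → U} (hτ : Measurable τ) {l : Measure (Fin 2 → X × U)}
    (hl : l ∈ selfJoiningsWithFaces G ν 2 Prod.snd (ρ.map fun u => (u, τ u)))
    (hlerg : ErgodicVAdd G (Fin 2 → X × U) l) {A : Set X} (hA : MeasurableSet A)
    (hne : l.real (Set.univ.pi ![A ×ˢ Set.univ, A ×ˢ Set.univ]) ≠ μ.real A * μ.real A) :
    ∃ R : X ≃ᵐ X, MeasurePreserving R μ μ ∧ ν.map (fun w => (R w.1, τ w.2)) = ν := by
  have := hl.1.isProbabilityMeasure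
  let g : (Fin 2 → X × U) → (Fin 2 → X) := fun w i => (w i).1
  have hg : Measurable g := by fun_prop
  have hface : IsErgodicSelfJoining G μ 2 (l.map g) := by
    have herg := hlerg.map_of_equivariant (f := g) hg fun _ _ => rfl
    refine ⟨⟨Measure.isProbabilityMeasure_map hg.aemeasurable, fun t =>
      ⟨measurable_const_vadd t, herg.map_vadd_eq t⟩, fun i => ?_⟩, herg⟩
    rw [Measure.map_map (measurable_pi_apply i) hg, ← hνμ, ← hl.1.marginal i,
      Measure.map_map measurable_fst (measurable_pi_apply i)]
    rfl
  have hnepi : l.map g ≠ Measure.pi fun _ => μ := by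
    intro h
    apply hne
    have h1 : l (Set.univ.pi ![A ×ˢ Set.univ, A ×ˢ Set.univ])
        = (l.map g) (Set.univ.pi fun _ => A) := by
      rw [Measure.map_apply hg (MeasurableSet.univ_pi fun _ => hA)]
      congr 1
      ext w
      simp [g, Set.mem_pi, Fin.forall_fin_two]
    rw [measureReal_def, h1, h, Measure.pi_pi]
    simp [measureReal_def, sq]
  -- The face supplied by simplicity may come in either order; the reversed one is handled by
  -- `S.symm`.
  have hR : ∃ R : X ≃ᵐ X, MeasurePreserving R μ μ ∧ ∀ᵐ w ∂l, (w 1).1 = R (w 0).1 := by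
    obtain ⟨i, j, hij, S, hS, hSeq⟩ := hsimple _ hface hnepi
    rw [Measure.map_map (by fun_prop) hg] at hSeq
    have hae := ae_eq_of_map_eq_diagonalShift (g := fun w : Fin 2 → X × U => (w i).1)
      (g' := fun w => (w j).1)
      (by fun_prop) (by fun_prop) S.measurable hSeq
    have hcase : (i = 0 ∧ j = 1) ∨ (i = 1 ∧ j = 0) := by omega
    rcases hcase with ⟨rfl, rfl⟩ | ⟨rfl, rfl⟩
    · exact ⟨S, hS.1, hae⟩
    · refine ⟨S.symm, hS.1.symm S, ?_⟩
      filter_upwards [hae] with w hw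
      rw [hw, S.symm_apply_apply]
  obtain ⟨R, hRμ, hRae⟩ := hR
  refine ⟨R, hRμ, ?_⟩
  have hτae : ∀ᵐ w ∂l, (w 1).2 = τ (w 0).2 :=
    ae_eq_of_map_eq_diagonalShift (μ := ρ) (g := fun w : Fin 2 → X × U => (w 0).2)
      (g' := fun w => (w 1).2)
      (by fun_prop) (by fun_prop) hτ (hl.2 0 1 (by simp))
  have hm : Measurable fun w : X × U => (R w.1, τ w.2) := by fun_prop
  -- The map `(R, τ)` carries the first coordinate of `l` to the second, and both have law `ν`.
  rw [← hl.1.marginal 0, Measure.map_map hm (measurable_pi_apply 0), hl.1.marginal 0,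
    ← hl.1.marginal 1]
  refine Measure.map_congr ?_
  filter_upwards [hRae, hτae] with w h1 h2
  exact Prod.ext h1.symm h2.symm

variable [MeasurableSpace Z] [StandardBorelSpace Z] [AddAction G Z] [MeasurableConstVAdd G Z]
  {ρ : Measure Z} [IsProbabilityMeasure ρ]

/-- At `s = 0` the correlation `∫ κ_u(A) κ_{τ u}(A)` differs from `μ(A)²`, and this persists for
small `s`. The relative product over the graph of `τ` realizes this correlation, and an ergodic
joining that is also correlated yields `R`. -/
theorem IsSimpleOfOrder.eventually_exists_map_eq [TopologicalSpace G]
    [FirstCountableTopology G] (hT : IsFlow G μ) (hsimple : IsSimpleOfOrder G μ 2)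
    {ν : Measure (X × X × Z)} [IsProbabilityMeasure ν]
    (hν : ErgodicVAdd G (X × X × Z) ν) (hν1 : ν.map Prod.fst = μ)
    (hν2 : ν.map Prod.snd = μ.prod ρ) (hne : ν ≠ μ.prod (μ.prod ρ)) :
    ∀ᶠ s : G in 𝓝 0, ∃ R : X ≃ᵐ X, MeasurePreserving R μ μ ∧
      ν.map (fun w => (R w.1, s +ᵥ w.2.1, w.2.2)) = ν := by
  have hX : Nonempty X := nonempty_of_isProbabilityMeasure μ
  have hswap : IsFiniteMeasure (ν.map Prod.swap) := inferInstance
  obtain ⟨κ, hκm, hκ⟩ : ∃ κ : Kernel (X × Z) X, IsMarkovKernel κ ∧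
      (μ.prod ρ).compProd κ = ν.map Prod.swap := by
    refine ⟨(ν.map Prod.swap).condKernel, inferInstance, ?_⟩
    have h := (ν.map Prod.swap).disintegrate (ν.map Prod.swap).condKernel
    rwa [Measure.fst_map_swap, Measure.snd, hν2] at h
  obtain ⟨A, hA, hAne⟩ := exists_integral_sq_ne_of_ne_prod hκ hν1 hne
  have hφ : Measurable fun u => (κ u).real A := (κ.measurable_coe hA).ennreal_toReal
  have htend := hT.tendsto_integral_mul_shift (ρ := ρ) hφ (fun u => measureReal_nonneg)
    (fun u => measureReal_le_one)
  filter_upwards [htend.eventually_ne hAne] with s hs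
  let τ : X × Z → X × Z := fun u => (s +ᵥ u.1, u.2)
  have hτ : Measurable τ :=
    ((measurable_const_vadd s).comp measurable_fst).prodMk measurable_snd
  have hτρ : MeasurePreserving τ (μ.prod ρ) (μ.prod ρ) :=
    (hT.measurePreserving s).prod (MeasurePreserving.id ρ)
  have hτG : ∀ (t : G) (u : X × Z), τ (t +ᵥ u) = t +ᵥ τ u := fun t u => by
    refine Prod.ext ?_ rfl
    change s +ᵥ (t +ᵥ u.1) = t +ᵥ (s +ᵥ u.1)
    rw [vadd_vadd, vadd_vadd, add_comm]
  have hη : ErgodicVAdd G (X × Z) (μ.prod ρ) :=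
    hν2 ▸ hν.map_of_equivariant measurable_snd fun _ _ => rfl
  have hτm : Measurable fun u => (u, τ u) := measurable_id.prodMk hτ
  have hσ : ErgodicVAdd G ((X × Z) × (X × Z)) ((μ.prod ρ).map fun u => (u, τ u)) :=
    hη.map_of_equivariant hτm fun t u => Prod.ext rfl (hτG t u)
  have : IsProbabilityMeasure ((μ.prod ρ).map fun u => (u, τ u)) :=
    Measure.isProbabilityMeasure_map hτm.aemeasurable
  have hmem : shiftedRelativeProduct (μ.prod ρ) κ hτ
      ∈ selfJoiningsWithFaces G ν 2 Prod.snd ((μ.prod ρ).map fun u => (u, τ u)) := by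
    refine ⟨⟨inferInstance, fun t => ⟨measurable_const_vadd t, ?_⟩, fun i => ?_⟩, ?_⟩
    · exact map_vadd_shiftedRelativeProduct hκ hη.map_vadd_eq hν.map_vadd_eq hτρ hτG t
    · fin_cases i
      · exact map_zero_shiftedRelativeProduct hκ
      · exact map_one_shiftedRelativeProduct hκ hτρ
    · intro p q hpq
      obtain ⟨rfl, rfl⟩ : p = 0 ∧ q = 1 := by omega
      exact map_snd_shiftedRelativeProduct
  have hrect : ∀ i, MeasurableSet ((![A ×ˢ Set.univ, A ×ˢ Set.univ] : Fin 2 → Set (X × X × Z)) i) := by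
    intro i
    fin_cases i <;> exact hA.prod .univ
  have hval : (shiftedRelativeProduct (μ.prod ρ) κ hτ).real
      (Set.univ.pi ![A ×ˢ Set.univ, A ×ˢ Set.univ]) ≠ μ.real A * μ.real A := by
    rw [measureReal_def, shiftedRelativeProduct_rectangle hA hA,
      ← integral_toReal (f := fun u => κ u A * κ (τ u) A) (((κ.measurable_coe hA).mul
        ((κ.measurable_coe hA).comp hτ)).aemeasurable)
        (ae_of_all _ fun u => ENNReal.mul_lt_top (measure_lt_top _ _) (measure_lt_top _ _))]
    simp_rw [ENNReal.toReal_mul]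
    exact hs
  -- Without such an `R`, every ergodic joining over this graph would give the rectangle the value
  -- `μ(A)²`, and then so would the relative product.
  by_contra hcon
  apply hval
  refine measure_pi_eq_of_forall_ergodic (G := G) measurable_snd (fun _ _ => rfl) hν hσ hrect ?_ hmem
  intro l hl hlerg
  by_contra hlne
  exact hcon (hsimple.exists_map_eq_of_ergodic hν1 hτ hl hlerg hA hlne)

/-- Some `s / (n + 1)` is small enough to have a symmetry; its `(n + 1)`-fold composition is a
symmetry for `s`. -/
theorem forall_exists_map_eq_of_eventually {d : ℕ} {X Z : Type*} [AddAction (Fin d → ℝ) X]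
    [MeasurableSpace X] [MeasurableSpace Z] [MeasurableConstVAdd (Fin d → ℝ) X]
    {μ : Measure X} {ν : Measure (X × X × Z)}
    (h : ∀ᶠ s : Fin d → ℝ in 𝓝 0, ∃ R : X ≃ᵐ X, MeasurePreserving R μ μ ∧
      ν.map (fun w => (R w.1, s +ᵥ w.2.1, w.2.2)) = ν) (s : Fin d → ℝ) :
    ∃ R : X ≃ᵐ X, MeasurePreserving R μ μ ∧
      ν.map (fun w => (R w.1, s +ᵥ w.2.1, w.2.2)) = ν := by
  have hlim : Tendsto (fun n : ℕ => (1 / ((n : ℝ) + 1)) • s) atTop (𝓝 0) := by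
    simpa using (tendsto_one_div_add_atTop_nhds_zero_nat (𝕜 := ℝ)).smul_const s
  obtain ⟨n, R₀, hR₀, hR₀ν⟩ := (hlim.eventually h).exists
  have hm : ∀ (R : X ≃ᵐ X) (t : Fin d → ℝ),
      Measurable fun w : X × X × Z => (R w.1, t +ᵥ w.2.1, w.2.2) := fun R t =>
    (R.measurable.comp measurable_fst).prodMk
      (((measurable_const_vadd t).comp (measurable_fst.comp measurable_snd)).prodMk
        (measurable_snd.comp measurable_snd))
  have hk : ∀ k : ℕ, ∃ R : X ≃ᵐ X, MeasurePreserving R μ μ ∧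
      ν.map (fun w => (R w.1, (k • ((1 / ((n : ℝ) + 1)) • s)) +ᵥ w.2.1, w.2.2)) = ν := by
    intro k
    induction k with
    | zero =>
      refine ⟨MeasurableEquiv.refl X, MeasurePreserving.id μ, ?_⟩
      simp
    | succ k ih =>
      obtain ⟨R, hR, hRν⟩ := ih
      refine ⟨R.trans R₀, hR₀.comp hR, ?_⟩
      conv_rhs => rw [← hR₀ν, ← hRν]
      rw [Measure.map_map (hm _ _) (hm _ _)]
      congr 1
      ext w
      · rfl
      · simp only [Function.comp, vadd_vadd, succ_nsmul']
      · rfl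
  have := hk (n + 1)
  rwa [← Nat.cast_smul_eq_nsmul ℝ, smul_smul, Nat.cast_succ, mul_one_div_cancel (by positivity),
    one_smul] at this

/-- For a weakly mixing 2-simple flow, an ergodic joining of two copies of the flow with a third
system is a product as soon as any two of the three systems are independent. -/
theorem IsSimpleOfOrder.eq_prod_of_pairwise_independent {d : ℕ} {X Z : Type*}
    [AddAction (Fin d → ℝ) X] [MeasurableSpace X] [StandardBorelSpace X]
    [MeasurableConstVAdd (Fin d → ℝ) X] {μ : Measure X} [IsProbabilityMeasure μ]
    [MeasurableSpace Z] [StandardBorelSpace Z] [AddAction (Fin d → ℝ) Z]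
    [MeasurableConstVAdd (Fin d → ℝ) Z] {ρ : Measure Z} [IsProbabilityMeasure ρ]
    (hT : IsFlow (Fin d → ℝ) μ) (hwm : IsWeaklyMixing (Fin d → ℝ) μ)
    (hsimple : IsSimpleOfOrder (Fin d → ℝ) μ 2) {ν : Measure (X × X × Z)}
    [IsProbabilityMeasure ν] (hν : ErgodicVAdd (Fin d → ℝ) (X × X × Z) ν)
    (hν12 : ν.map (fun w => (w.1, w.2.1)) = μ.prod μ)
    (hν13 : ν.map (fun w => (w.1, w.2.2)) = μ.prod ρ) (hν23 : ν.map Prod.snd = μ.prod ρ) :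
    ν = μ.prod (μ.prod ρ) := by
  by_contra hne
  have hν1 : ν.map Prod.fst = μ := by
    have : (ν.map (fun w => (w.1, w.2.1))).map Prod.fst = μ := by
      rw [hν12]
      exact measurePreserving_fst.map_eq
    rwa [Measure.map_map measurable_fst (by fun_prop)] at this
  have hall := forall_exists_map_eq_of_eventually
    (hsimple.eventually_exists_map_eq hT hν hν1 hν23 hne)
  apply hne
  refine Measure.ext_prod₃ fun {A B C} hA hB hC => ?_
  let β : Measure (X × X) :=
    (ν.restrict ((fun w => w.2.2) ⁻¹' C)).map fun w => (w.1, w.2.1)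
  have hm12 : Measurable fun w : X × X × Z => (w.1, w.2.1) := by fun_prop
  have hC' : MeasurableSet ((fun w : X × X × Z => w.2.2) ⁻¹' C) :=
    (measurable_snd.comp measurable_snd) hC
  have hβle : β ≤ μ.prod μ := by
    rw [← hν12]
    exact Measure.map_mono Measure.restrict_le_self hm12
  have hβ : ∀ D E, MeasurableSet D → MeasurableSet E → β (D ×ˢ E) = ν (D ×ˢ E ×ˢ C) := by
    intro D E hD hE
    rw [Measure.map_apply hm12 (hD.prod hE), Measure.restrict_apply (hm12 (hD.prod hE))]
    congr 1
    ext w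
    simp [and_assoc]
  -- The symmetry of `ν` fixes the third coordinate, so it preserves the restriction to `z ∈ C`, and
  -- `β` is invariant under `R × T_s`.
  have hprod := hwm.measure_prod_eq_of_le_prod (ρ := μ) hβle (fun s => by
    obtain ⟨R, hR, hRν⟩ := hall s
    refine ⟨R, hR, ?_⟩
    have hmR : Measurable fun p : X × X => (R p.1, s +ᵥ p.2) :=
      (R.measurable.comp measurable_fst).prodMk ((measurable_const_vadd s).comp measurable_snd)
    have hmM : Measurable fun w : X × X × Z => (R w.1, s +ᵥ w.2.1, w.2.2) :=
      (R.measurable.comp measurable_fst).prodMk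
        (((measurable_const_vadd s).comp (measurable_fst.comp measurable_snd)).prodMk
          (measurable_snd.comp measurable_snd))
    have hres : (ν.restrict ((fun w => w.2.2) ⁻¹' C)).map
        (fun w => (R w.1, s +ᵥ w.2.1, w.2.2)) = ν.restrict ((fun w => w.2.2) ⁻¹' C) := by
      conv_rhs => rw [← hRν]
      rw [Measure.restrict_map hmM hC']
      rfl
    change (Measure.map _ (ν.restrict _)).map _ = Measure.map _ (ν.restrict _)
    conv_rhs => rw [← hres]
    rw [Measure.map_map hmR hm12, Measure.map_map hm12 hmM]
    rfl) hA hB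
  have hAC : ν (A ×ˢ Set.univ ×ˢ C) = μ A * ρ C := by
    rw [← Measure.prod_prod, ← hν13, Measure.map_apply (by fun_prop) (hA.prod hC)]
    congr 1
    ext w
    simp
  rw [← hβ A B hA hB, hprod, hβ A _ hA .univ, hAC, Measure.prod_prod, Measure.prod_prod]
  ring

end TripleStep

/-! ### Faces of self-joinings. -/

section Faces

variable {G : Type*} [AddGroup G] {X : Type*} [AddAction G X] [MeasurableSpace X]
  {μ : Measure X}

theorem map_cons_zero_tail_pi [IsProbabilityMeasure μ] (m : ℕ) :
    (Measure.pi fun _ : Fin (m + 1) => μ).map (fun w => (w 0, fun i : Fin m => w i.succ))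
      = μ.prod (Measure.pi fun _ => μ) :=
  (measurePreserving_piFinSuccAbove (fun _ : Fin (m + 1) => μ) 0).map_eq

theorem measurable_faceMap {n m : ℕ} (e : Fin m → Fin n) :
    Measurable fun (w : Fin n → X) (i : Fin m) => w (e i) := by fun_prop

theorem IsErgodicSelfJoining.map_face [MeasurableConstVAdd G X] {n m : ℕ}
    {ν : Measure (Fin n → X)} (hν : IsErgodicSelfJoining G μ n ν) (e : Fin m → Fin n) :
    IsErgodicSelfJoining G μ m (ν.map fun w i => w (e i)) := by
  have := hν.1.isProbabilityMeasure
  have hm : Measurable fun (w : Fin n → X) (i : Fin m) => w (e i) := measurable_faceMap e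
  have herg := hν.2.map_of_equivariant hm fun _ _ => rfl
  refine ⟨⟨Measure.isProbabilityMeasure_map hm.aemeasurable, fun t =>
    ⟨measurable_const_vadd t, herg.map_vadd_eq t⟩, fun i => ?_⟩, herg⟩
  rw [Measure.map_map (measurable_pi_apply i) hm]
  exact hν.1.marginal (e i)

theorem map_face_map_pair {n m : ℕ} (ν : Measure (Fin n → X)) (e : Fin m → Fin n) (i j : Fin m) :
    (ν.map fun w i => w (e i)).map (fun x => (x i, x j))
      = ν.map fun x => (x (e i), x (e j)) := by
  rw [Measure.map_map (by fun_prop) (measurable_faceMap e)]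
  rfl

theorem map_pair_pi_two [IsProbabilityMeasure μ] :
    (Measure.pi fun _ : Fin 2 => μ).map (fun w => (w 0, w 1)) = μ.prod μ :=
  (measurePreserving_finTwoArrow μ).map_eq

end Faces

/-! ### From pairwise independence to independence, and simplicity of all orders. -/

section PairwiseIndependence

variable {d : ℕ} {X : Type*} [AddAction (Fin d → ℝ) X] [MeasurableSpace X]
  [StandardBorelSpace X] [MeasurableConstVAdd (Fin d → ℝ) X] {μ : Measure X}
  [IsProbabilityMeasure μ]

/-- In a weakly mixing 2-simple flow, pairwise independent ergodic self-joinings are products. -/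
theorem IsSimpleOfOrder.eq_pi_of_pairwise_independent (hT : IsFlow (Fin d → ℝ) μ)
    (hwm : IsWeaklyMixing (Fin d → ℝ) μ) (hsimple : IsSimpleOfOrder (Fin d → ℝ) μ 2) {n : ℕ}
    {ν : Measure (Fin n → X)} (hν : IsErgodicSelfJoining (Fin d → ℝ) μ n ν)
    (hpair : ∀ i j, i < j → ν.map (fun x => (x i, x j)) = μ.prod μ) :
    ν = Measure.pi fun _ => μ := by
  have := hν.1.isProbabilityMeasure
  induction n with
  | zero =>
    refine Measure.ext_of_pi fun A hA => ?_
    have h : Set.univ.pi A = Set.univ := Set.eq_univ_of_forall fun w p => p.elim0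
    simp [h]
  | succ n ih =>
  rcases n with _ | n
  · refine Measure.ext_of_pi fun A hA => ?_
    rw [Measure.pi_pi, Fin.prod_univ_one, ← hν.1.marginal 0,
      Measure.map_apply (measurable_pi_apply 0) (hA 0)]
    congr 1
    ext w
    simp [Set.mem_pi]
  rcases n with _ | n
  · refine Measure.ext_of_pi fun A hA => ?_
    rw [Measure.pi_pi, Fin.prod_univ_two, ← Measure.prod_prod, ← hpair 0 1 (by simp),
      Measure.map_apply (by fun_prop) ((hA 0).prod (hA 1))]
    congr 1
    ext w
    simp [Set.mem_pi, Fin.forall_fin_two]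
  have hface : ∀ e : Fin (n + 2) → Fin (n + 3), StrictMono e →
      ν.map (fun w => (w (e 0), fun i : Fin (n + 1) => w (e i.succ)))
        = μ.prod (Measure.pi fun _ => μ) := by
    intro e he
    have h1 := hν.map_face e
    have h2 := ih h1 (fun i j hij => by
      rw [map_face_map_pair]
      exact hpair _ _ (he hij)) h1.1.isProbabilityMeasure
    rw [← map_cons_zero_tail_pi, ← h2, Measure.map_map (by fun_prop) (measurable_faceMap e)]
    rfl
  -- The third system is the block of the last `n + 1` coordinates; its independence from either
  -- single coordinate comes from the induction hypothesis on faces of dimension `n + 2`.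
  let g : (Fin (n + 3) → X) → X × X × (Fin (n + 1) → X) :=
    fun w => (w 0, w 1, fun i => w i.succ.succ)
  have hg : Measurable g := by fun_prop
  have hgprob : IsProbabilityMeasure (ν.map g) :=
    Measure.isProbabilityMeasure_map hg.aemeasurable
  have hprod : ν.map g = μ.prod (μ.prod (Measure.pi fun _ => μ)) := by
    refine hsimple.eq_prod_of_pairwise_independent hT hwm
      (hν.2.map_of_equivariant hg fun _ _ => rfl) ?_ ?_ ?_
    · rw [Measure.map_map (by fun_prop) hg]
      exact hpair 0 1 (by simp)
    -- `succAbove 1` omits coordinate `1`; `succ`, used next, omits coordinate `0`.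
    · rw [Measure.map_map (by fun_prop) hg, ← hface _ (Fin.strictMono_succAbove 1)]
      rfl
    · rw [Measure.map_map (by fun_prop) hg, ← hface _ (Fin.strictMono_succ)]
      rfl
  refine Measure.ext_of_pi fun A hA => ?_
  have h1 : Set.univ.pi A
      = g ⁻¹' (A 0 ×ˢ A 1 ×ˢ Set.univ.pi fun i : Fin (n + 1) => A i.succ.succ) := by
    ext w
    simp [g, Set.mem_pi, Fin.forall_fin_succ (n := n + 2), Fin.forall_fin_succ (n := n + 1)]
  rw [Measure.pi_pi, h1, ← Measure.map_apply hg
    ((hA 0).prod ((hA 1).prod (MeasurableSet.univ_pi fun _ => hA _))), hprod, Measure.prod_prod,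
    Measure.prod_prod, Measure.pi_pi, Fin.prod_univ_succ (fun p => μ (A p)),
    Fin.prod_univ_succ (fun p : Fin (n + 2) => μ (A p.succ))]
  rfl

theorem IsSimpleOfOrder.exists_face_ne_pi (hT : IsFlow (Fin d → ℝ) μ)
    (hwm : IsWeaklyMixing (Fin d → ℝ) μ) (hsimple : IsSimpleOfOrder (Fin d → ℝ) μ 2) {n : ℕ}
    {ν : Measure (Fin n → X)} (hν : IsErgodicSelfJoining (Fin d → ℝ) μ n ν)
    (hne : ν ≠ Measure.pi fun _ => μ) :
    ∃ e : Fin 2 → Fin n, Function.Injective e ∧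
      (ν.map fun w i => w (e i)) ≠ Measure.pi fun _ => μ := by
  by_contra! hcon
  refine hne (hsimple.eq_pi_of_pairwise_independent hT hwm hν fun i j hij => ?_)
  have h := hcon ![i, j] (by
    intro a b hab
    fin_cases a <;> fin_cases b <;> simp_all [hij.ne, hij.ne'])
  have h2 := map_face_map_pair ν ![i, j] 0 1
  rw [h, map_pair_pi_two] at h2
  exact h2.symm

/-- A weakly mixing 2-simple flow is simple of every order. -/
theorem IsSimpleOfOrder.of_two (hT : IsFlow (Fin d → ℝ) μ)
    (hwm : IsWeaklyMixing (Fin d → ℝ) μ) (hsimple : IsSimpleOfOrder (Fin d → ℝ) μ 2) (n : ℕ) :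
    IsSimpleOfOrder (Fin d → ℝ) μ n := by
  intro ν hν hne
  obtain ⟨e, he, hene⟩ := hsimple.exists_face_ne_pi hT hwm hν hne
  obtain ⟨i, j, hij, S, hS, hSeq⟩ := hsimple _ (hν.map_face e) hene
  rw [map_face_map_pair] at hSeq
  exact ⟨e i, e j, he.ne hij, S, hS, hSeq⟩

end PairwiseIndependence

/-! ### Minimal self-joinings: passing between orders. -/

section MinimalSelfJoinings

variable {X : Type*} [MeasurableSpace X] {μ : Measure X}

theorem HasMinimalSelfJoinings.isSimpleOfOrder {G : Type*} [AddCommGroup G] [AddAction G X]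
    [MeasurableConstVAdd G X] {n : ℕ}
    (hinv : ∀ t : G, MeasurePreserving (fun x : X => t +ᵥ x) μ μ)
    (h : HasMinimalSelfJoinings G μ n) : IsSimpleOfOrder G μ n := by
  intro ν hν hne
  obtain ⟨i, j, hij, t, ht⟩ := h ν hν hne
  refine ⟨i, j, hij, MeasurableEquiv.vadd t, ⟨hinv t, fun s => ae_of_all _ fun x => ?_⟩, ht⟩
  change t +ᵥ (s +ᵥ x) = s +ᵥ (t +ᵥ x)
  rw [vadd_vadd, vadd_vadd, add_comm]

/-- Disposes of the degenerate case where `μ` is trivial, the only one in which `μ ⊗ μ` can be the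
graph of an element of the action. -/
theorem IsSelfJoining.eq_pi_of_forall_eq_zero_or_one {G : Type*} [AddGroup G]
    [AddAction G X] [IsProbabilityMeasure μ] {n : ℕ} {ν : Measure (Fin n → X)}
    (hν : IsSelfJoining G μ n ν) (h : ∀ A, MeasurableSet A → μ A = 0 ∨ μ A = 1) :
    ν = Measure.pi fun _ => μ := by
  have := hν.isProbabilityMeasure
  refine Measure.ext_of_pi fun A hA => ?_
  rw [Measure.pi_pi]
  by_cases h0 : ∃ p, μ (A p) = 0
  · obtain ⟨p, hp⟩ := h0
    rw [Finset.prod_eq_zero (Finset.mem_univ p) hp]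
    rw [← hν.marginal p, Measure.map_apply (measurable_pi_apply p) (hA p)] at hp
    exact measure_mono_null (fun w hw => hw p trivial) hp
  · push Not at h0
    have h1 : ∀ p, μ (A p) = 1 := fun p => (h _ (hA p)).resolve_left (h0 p)
    rw [Finset.prod_eq_one fun p _ => h1 p,
      ← mem_ae_iff_prob_eq_one (MeasurableSet.univ_pi hA)]
    have h2 : ∀ᵐ w ∂ν, ∀ p, w p ∈ A p := by
      refine ae_all_iff.2 fun p => ?_
      have h3 : ∀ᵐ x ∂μ, x ∈ A p := (mem_ae_iff_prob_eq_one (hA p)).2 (h1 p)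
      rw [← hν.marginal p] at h3
      exact ae_of_ae_map (measurable_pi_apply p).aemeasurable h3
    filter_upwards [h2] with w hw p _ using hw p

variable [IsProbabilityMeasure μ]

theorem HasMinimalSelfJoinings.of_two {d : ℕ} [StandardBorelSpace X] [AddAction (Fin d → ℝ) X]
    [MeasurableConstVAdd (Fin d → ℝ) X] (hT : IsFlow (Fin d → ℝ) μ)
    (hwm : IsWeaklyMixing (Fin d → ℝ) μ) (h : HasMinimalSelfJoinings (Fin d → ℝ) μ 2) (n : ℕ) :
    HasMinimalSelfJoinings (Fin d → ℝ) μ n := by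
  intro ν hν hne
  obtain ⟨e, he, hene⟩ :=
    (h.isSimpleOfOrder hT.measurePreserving).exists_face_ne_pi hT hwm hν hne
  obtain ⟨i, j, hij, t, ht⟩ := h _ (hν.map_face e) hene
  rw [map_face_map_pair] at ht
  exact ⟨e i, e j, he.ne hij, t, ht⟩

variable {G : Type*} [AddGroup G] [AddAction G X] [MeasurableConstVAdd G X]

/-- If independent points are related by an element of the action, then all sets are trivial. -/
theorem measure_eq_zero_or_one_of_prod_eq_diagonalShift {t : G}
    (h : μ.prod μ = diagonalShift μ fun x => t +ᵥ x) {A : Set X} (hA : MeasurableSet A) :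
    μ A = 0 ∨ μ A = 1 := by
  have hB : MeasurableSet ((fun x : X => -t +ᵥ x) ⁻¹' A) := measurable_const_vadd (-t) hA
  have hD : ∀ D : Set (X × X), MeasurableSet D →
      diagonalShift μ (fun x => t +ᵥ x) D = μ ((fun x => (x, t +ᵥ x)) ⁻¹' D) := fun D hD =>
    Measure.map_apply (f := fun x => (x, t +ᵥ x))
      (measurable_id.prodMk (measurable_const_vadd t)) hD
  -- The test set is `A × (t + A)`: the graph gives it `μ A`, the product gives it `μ(A)²`.
  have h1 := congrArg (fun m : Measure (X × X) => m (A ×ˢ ((fun x => -t +ᵥ x) ⁻¹' A))) h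
  have h2 : μ ((fun x : X => -t +ᵥ x) ⁻¹' A) = μ A := by
    have h3 := congrArg (fun m : Measure (X × X) =>
      m (Set.univ ×ˢ ((fun x => -t +ᵥ x) ⁻¹' A))) h
    simp only [Measure.prod_prod, measure_univ, one_mul] at h3
    rw [h3, hD _ (MeasurableSet.univ.prod hB)]
    congr 1
    ext x
    simp
  simp only [Measure.prod_prod, h2] at h1
  rw [hD _ (hA.prod hB)] at h1
  have h4 : (fun x => (x, t +ᵥ x)) ⁻¹' (A ×ˢ ((fun x => -t +ᵥ x) ⁻¹' A)) = A := by
    ext x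
    simp
  rw [h4] at h1
  by_cases h0 : μ A = 0
  · exact Or.inl h0
  · exact Or.inr ((ENNReal.mul_eq_left h0 (measure_ne_top _ _)).1 h1)

/-- For weakly mixing actions, minimal self-joinings pass to lower orders. -/
theorem HasMinimalSelfJoinings.of_succ (hwm : IsWeaklyMixing G μ) {n : ℕ}
    (h : HasMinimalSelfJoinings G μ (n + 1)) : HasMinimalSelfJoinings G μ n := by
  intro ν hν hne
  have := hν.1.isProbabilityMeasure
  let g : (Fin n → X) × X → Fin (n + 1) → X := fun p => Fin.cons p.2 p.1
  have hg : Measurable g := by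
    refine measurable_pi_iff.2 fun i => ?_
    cases i using Fin.cases with
    | zero => exact measurable_snd
    | succ i => exact (measurable_pi_apply i).comp measurable_fst
  have hgeq : ∀ (t : G) (p : (Fin n → X) × X), g (t +ᵥ p) = t +ᵥ g p := by
    intro t p
    ext i
    cases i using Fin.cases <;> rfl
  have hgprob : IsProbabilityMeasure ((ν.prod μ).map g) :=
    Measure.isProbabilityMeasure_map hg.aemeasurable
  have herg := (hwm.ergodicVAdd_prod hν.2).map_of_equivariant hg hgeq
  have htail : ((ν.prod μ).map g).map (fun w (i : Fin n) => w i.succ) = ν := by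
    rw [Measure.map_map (measurable_faceMap Fin.succ) hg]
    exact measurePreserving_fst.map_eq
  have hpair : ∀ i : Fin n, ((ν.prod μ).map fun p => (p.1 i, p.2)) = μ.prod μ := by
    intro i
    have := Measure.map_prod_map ν μ (measurable_pi_apply i) measurable_id
    rw [Measure.map_id, hν.1.marginal i] at this
    exact this.symm
  have hpair' : ∀ i : Fin n, ((ν.prod μ).map fun p => (p.2, p.1 i)) = μ.prod μ := by
    intro i
    rw [← Measure.prod_swap (μ := μ) (ν := μ), ← hpair i,
      Measure.map_map measurable_swap (by fun_prop)]
    rfl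
  have hjoin : IsErgodicSelfJoining G μ (n + 1) ((ν.prod μ).map g) := by
    refine ⟨⟨hgprob, fun t => ⟨measurable_const_vadd t, herg.map_vadd_eq t⟩, fun i => ?_⟩, herg⟩
    cases i using Fin.cases with
    | zero =>
      rw [Measure.map_map (measurable_pi_apply _) hg]
      exact measurePreserving_snd.map_eq
    | succ i =>
      have h1 := congrArg (Measure.map fun w => w i) htail
      rwa [Measure.map_map (measurable_pi_apply i) (measurable_faceMap Fin.succ),
        hν.1.marginal i] at h1
  obtain ⟨i, j, hij, t, ht⟩ := h _ hjoin fun hpi => by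
    apply hne
    rw [← htail, hpi]
    have h1 := congrArg (fun m => Measure.map Prod.snd m) (map_cons_zero_tail_pi (μ := μ) n)
    rw [Measure.map_map measurable_snd (by fun_prop)] at h1
    exact h1.trans measurePreserving_snd.map_eq
  rw [Measure.map_map (by fun_prop) hg] at ht
  -- A face involving the adjoined coordinate is `μ ⊗ μ`, so it cannot be a graph; the face found
  -- must lie inside `ν`.
  have htriv : μ.prod μ = diagonalShift μ (fun x => t +ᵥ x) → False := fun htr =>
    hne (hν.1.eq_pi_of_forall_eq_zero_or_one fun A hA =>
      measure_eq_zero_or_one_of_prod_eq_diagonalShift htr hA)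
  cases i using Fin.cases with
  | zero =>
    cases j using Fin.cases with
    | zero => exact absurd rfl hij
    | succ j => exact (htriv ((hpair' j).symm.trans ht)).elim
  | succ i =>
    cases j using Fin.cases with
    | zero => exact (htriv ((hpair i).symm.trans ht)).elim
    | succ j =>
      refine ⟨i, j, fun hh => hij (congrArg _ hh), t, ?_⟩
      rw [← ht]
      nth_rw 1 [← (measurePreserving_fst (μ := ν) (ν := μ)).map_eq]
      rw [Measure.map_map (by fun_prop) measurable_fst]
      rfl

end MinimalSelfJoinings

/-! ### Mixing: weak mixing and mixing of all multiplicities. -/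

section Mixing

variable {X : Type*} [MeasurableSpace X] {μ : Measure X} [IsProbabilityMeasure μ]
  [StandardBorelSpace X]

/-- A mixing action of a noncompact group is weakly mixing. -/
theorem IsMixing.isWeaklyMixing {G : Type*} [AddGroup G] [TopologicalSpace G]
    [NeBot (cocompact G)] [AddAction G X] [MeasurableConstVAdd G X]
    (hinv : ∀ t : G, MeasurePreserving (fun x : X => t +ᵥ x) μ μ) (hmix : IsMixing G μ) :
    IsWeaklyMixing G μ := by
  have hpres : ∀ t : G, MeasurePreserving (fun p : X × X => t +ᵥ p) (μ.prod μ) (μ.prod μ) :=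
    fun t => (hinv t).prod (hinv t)
  refine { measure_preimage_vadd := fun t s hs => (hpres t).measure_preimage hs.nullMeasurableSet,
           aeconst_of_forall_preimage_vadd_ae_eq := fun {E} hE hEinv => ?_ }
  -- A limit at infinity of the graph joinings of `T_t × T_t` handles all measurable sets at once.
  -- It is the product, so an invariant `E` satisfies `m(E) = m(E)²` with `m = μ ⊗ μ`.
  let g : G → X × X → Fin 2 → X × X := fun t p => ![p, t +ᵥ p]
  have hg : ∀ t, Measurable (g t) := fun t => measurable_pi_iff.2 fun i => by
    fin_cases i
    · exact measurable_id
    · exact measurable_const_vadd t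
  have hrect : ∀ {A B : Set (X × X)}, MeasurableSet A → MeasurableSet B →
      ∀ p, MeasurableSet ((![A, B] : Fin 2 → Set (X × X)) p) := by
    intro A B hA hB p
    fin_cases p
    exacts [hA, hB]
  have hval : ∀ t {A B : Set (X × X)}, MeasurableSet A → MeasurableSet B →
      ((μ.prod μ).map (g t)) (Set.univ.pi ![A, B])
        = (μ.prod μ) (A ∩ (fun p => t +ᵥ p) ⁻¹' B) := by
    intro t A B hA hB
    rw [Measure.map_apply (hg t) (MeasurableSet.univ_pi (hrect hA hB))]
    congr 1
    ext p
    simp [g, Set.mem_pi, Fin.forall_fin_two]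
  obtain ⟨l, hl, -, hlim⟩ := exists_tendsto_measure_pi_of_marginal (ν := μ.prod μ)
    (Ultrafilter.of (cocompact G)) (l := fun t => (μ.prod μ).map (g t))
    (fun t => Measure.isProbabilityMeasure_map (hg t).aemeasurable) (fun t p => by
      rw [Measure.map_map (measurable_pi_apply p) (hg t)]
      fin_cases p
      · exact Measure.map_id
      · exact (hpres t).map_eq)
  have hlim' : ∀ {A B : Set (X × X)}, MeasurableSet A → MeasurableSet B →
      Tendsto (fun t => (μ.prod μ) (A ∩ (fun p => t +ᵥ p) ⁻¹' B))
        (Ultrafilter.of (cocompact G) : Filter G) (𝓝 (l.map (fun w => (w 0, w 1)) (A ×ˢ B))) := by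
    intro A B hA hB
    have h := hlim _ (hrect hA hB)
    simp_rw [hval _ hA hB] at h
    convert h using 2
    rw [Measure.map_apply (by fun_prop) (hA.prod hB)]
    congr 1
    ext w
    simp [Set.mem_pi, Fin.forall_fin_two]
  have hprob : IsProbabilityMeasure (l.map fun w => (w 0, w 1)) :=
    Measure.isProbabilityMeasure_map (by fun_prop)
  -- Mixing gives the factorization on products of four sets; it is then extended to arbitrary sets
  -- one side at a time.
  have hprod : l.map (fun w => (w 0, w 1)) = (μ.prod μ).prod (μ.prod μ) := by
    have hbase : ∀ {B C B' C' : Set X}, MeasurableSet B → MeasurableSet C → MeasurableSet B' →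
        MeasurableSet C' → l.map (fun w => (w 0, w 1)) ((B ×ˢ C) ×ˢ (B' ×ˢ C'))
          = (μ.prod μ) (B ×ˢ C) * (μ.prod μ) (B' ×ˢ C') := by
      intro B C B' C' hB hC hB' hC'
      refine tendsto_nhds_unique (hlim' (hB.prod hC) (hB'.prod hC')) ?_
      have h1 : ∀ t : G, (μ.prod μ) ((B ×ˢ C) ∩ (fun p => t +ᵥ p) ⁻¹' (B' ×ˢ C'))
          = μ (B ∩ (fun x => t +ᵥ x) ⁻¹' B') * μ (C ∩ (fun x => t +ᵥ x) ⁻¹' C') := by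
        intro t
        rw [← Measure.prod_prod]
        congr 1
        ext p
        exact and_and_and_comm
      simp_rw [h1, Measure.prod_prod]
      have h2 : μ B * μ C * (μ B' * μ C') = μ B * μ B' * (μ C * μ C') := by ring
      rw [h2]
      exact (ENNReal.Tendsto.mul (hmix B B' hB hB')
        (Or.inr (ENNReal.mul_ne_top (measure_ne_top _ _) (measure_ne_top _ _)))
        (hmix C C' hC hC')
        (Or.inr (ENNReal.mul_ne_top (measure_ne_top _ _) (measure_ne_top _ _)))).mono_left
        (Ultrafilter.of_le _)
    have hslice : ∀ {A B' C'}, MeasurableSet A → MeasurableSet B' → MeasurableSet C' →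
        l.map (fun w => (w 0, w 1)) (A ×ˢ (B' ×ˢ C')) = (μ.prod μ) A * (μ.prod μ) (B' ×ˢ C') := by
      intro A B' C' hA hB' hC'
      have h1 : ((l.map fun w => (w 0, w 1)).restrict (Set.univ ×ˢ (B' ×ˢ C'))).fst
          = (μ.prod μ) (B' ×ˢ C') • μ.prod μ := by
        refine Measure.ext_prod fun {B C} hB hC => ?_
        rw [Measure.fst_apply (hB.prod hC), Measure.restrict_apply (measurable_fst (hB.prod hC)),
          Measure.smul_apply, smul_eq_mul, mul_comm, ← hbase hB hC hB' hC']
        congr 1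
        ext w
        simp [and_assoc]
      have h2 := congrArg (fun m : Measure (X × X) => m A) h1
      simp only [Measure.smul_apply, smul_eq_mul] at h2
      rw [Measure.fst_apply hA, Measure.restrict_apply (measurable_fst hA)] at h2
      rw [mul_comm, ← h2]
      congr 1
      ext w
      simp
    symm
    refine Measure.prod_eq fun A D hA hD => ?_
    have h1 : ((l.map fun w => (w 0, w 1)).restrict (A ×ˢ Set.univ)).snd
        = (μ.prod μ) A • μ.prod μ := by
      refine Measure.ext_prod fun {B C} hB hC => ?_
      rw [Measure.snd_apply (hB.prod hC), Measure.restrict_apply (measurable_snd (hB.prod hC)),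
        Measure.smul_apply, smul_eq_mul, ← hslice hA hB hC]
      congr 1
      ext w
      simp
      tauto
    have h2 := congrArg (fun m : Measure (X × X) => m D) h1
    simp only [Measure.smul_apply, smul_eq_mul] at h2
    rw [Measure.snd_apply hD, Measure.restrict_apply (measurable_snd hD)] at h2
    rw [← h2]
    congr 1
    ext w
    simp [and_comm]
  have hEE : (μ.prod μ) E = (μ.prod μ) E * (μ.prod μ) E := by
    have h1 := hlim' hE hE
    rw [hprod, Measure.prod_prod] at h1
    refine tendsto_nhds_unique (tendsto_const_nhds.congr fun t => ?_) h1
    refine (measure_congr ?_).symm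
    exact ((ae_eq_refl E).inter (hEinv t)).trans
      (Set.inter_self E).eventuallyEq
  rw [eventuallyConst_set]
  by_cases h0 : (μ.prod μ) E = 0
  · exact Or.inr (measure_eq_zero_iff_ae_notMem.1 h0)
  · left
    exact (mem_ae_iff_prob_eq_one hE).2
      ((ENNReal.mul_eq_left h0 (measure_ne_top _ _)).1 hEE.symm)

/-- A mixing 2-simple flow is mixing with every multiplicity. -/
theorem IsMixing.isMixingWithMultiplicity {d : ℕ} [NeBot (cocompact (Fin d → ℝ))]
    [AddAction (Fin d → ℝ) X] [MeasurableConstVAdd (Fin d → ℝ) X]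
    (hT : IsFlow (Fin d → ℝ) μ) (hmix : IsMixing (Fin d → ℝ) μ)
    (hsimple : IsSimpleOfOrder (Fin d → ℝ) μ 2) (k : ℕ) :
    IsMixingWithMultiplicity (Fin d → ℝ) μ k := by
  intro A hA t ht
  have hwm := hmix.isWeaklyMixing hT.measurePreserving
  rw [tendsto_iff_ultrafilter]
  intro U hU
  let g : ℕ → X → Fin (k + 1) → X := fun m x p => t p m +ᵥ x
  have hg : ∀ m, Measurable (g m) := fun m =>
    measurable_pi_iff.2 fun p => measurable_const_vadd (t p m)
  obtain ⟨l, hl, hlμ, hlim⟩ := exists_tendsto_measure_pi_of_marginal (ν := μ) U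
    (l := fun m => μ.map (g m))
    (fun m => Measure.isProbabilityMeasure_map (hg m).aemeasurable) (fun m p => by
      rw [Measure.map_map (measurable_pi_apply p) (hg m)]
      exact (hT.measurePreserving _).map_eq)
  -- Commutativity of the group makes the limit invariant. Its faces are `μ ⊗ μ` by mixing applied
  -- to the differences `t q m - t p m`.
  have hmem : l ∈ selfJoiningsWithFaces (Fin d → ℝ) μ (k + 1) id (μ.prod μ) := by
    refine ⟨⟨hl, fun s => ⟨measurable_const_vadd s, ?_⟩, hlμ⟩, fun p q hpq => ?_⟩
    · have : IsProbabilityMeasure (l.map fun w : Fin (k + 1) → X => s +ᵥ w) :=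
        Measure.isProbabilityMeasure_map (measurable_const_vadd s).aemeasurable
      refine Measure.ext_of_pi fun B hB => ?_
      rw [map_vadd_pi_apply l s hB]
      refine tendsto_nhds_unique (hlim _ fun p => measurable_const_vadd s (hB p))
        ((hlim B hB).congr fun m => ?_)
      rw [← map_vadd_pi_apply _ s hB, map_vadd_map_of_equivariant (hg m) ?_,
        (hT.measurePreserving s).map_eq]
      intro s x
      ext p
      change t p m +ᵥ (s +ᵥ x) = s +ᵥ (t p m +ᵥ x)
      rw [vadd_vadd, vadd_vadd, add_comm]
    · have : IsProbabilityMeasure (l.map fun w => (id (w p), id (w q))) :=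
        Measure.isProbabilityMeasure_map (by fun_prop)
      refine Measure.ext_prod fun {B B'} hB hB' => ?_
      rw [map_face_prod_apply measurable_id _ _ _ hB hB', Measure.prod_prod]
      refine tendsto_nhds_unique (hlim _ (measurableSet_twoFaceRectangle p q
        (measurable_id hB) (measurable_id hB'))) ?_
      have h1 := ((hmix B B' hB hB').comp (ht q p hpq.ne')).mono_left hU
      refine h1.congr fun m => ?_
      rw [Measure.map_apply (hg m)
        (MeasurableSet.univ_pi (measurableSet_twoFaceRectangle p q
        (measurable_id hB) (measurable_id hB'))),
        Function.comp, ← (hT.measurePreserving (t p m)).measure_preimage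
          (hB.inter (measurable_const_vadd _ hB')).nullMeasurableSet]
      congr 1
      rw [Set.preimage_id, Set.preimage_id, pi_twoFaceRectangle]
      ext x
      simp [g, vadd_vadd]
  -- The limit `l` need not be ergodic. Since `μ ⊗ μ` is ergodic by weak mixing, it suffices to know
  -- the pairwise independent ergodic joinings, and these are products.
  have hval := measure_pi_eq_of_forall_ergodic (G := Fin d → ℝ) measurable_id (fun _ _ => rfl)
    hwm.ergodicVAdd hwm hA (c := ∏ p, μ.real (A p)) (fun l' hl' herg => by
      rw [hsimple.eq_pi_of_pairwise_independent hT hwm ⟨hl'.1, herg⟩ fun i j hij => hl'.2 i j hij]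
      simp [measureReal_def, Measure.pi_pi, ENNReal.toReal_prod]) hmem
  have hval' : l (Set.univ.pi A) = ∏ p, μ (A p) := by
    refine (ENNReal.toReal_eq_toReal_iff' (measure_ne_top _ _)
      (ENNReal.prod_ne_top fun p _ => measure_ne_top _ _)).1 ?_
    rw [ENNReal.toReal_prod]
    exact hval
  rw [← hval']
  refine (hlim A hA).congr fun m => ?_
  rw [Measure.map_apply (hg m) (MeasurableSet.univ_pi hA)]
  congr 1
  ext x
  simp [g]

end Mixing

theorem mainTheorem3 (d : ℕ) (hd : 1 ≤ d) {X : Type*} [MeasurableSpace X] [StandardBorelSpace X]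
    (μ : Measure X) [IsProbabilityMeasure μ] [AddAction (Fin d → ℝ) X]
    (hT : IsFlow (Fin d → ℝ) μ) :
    (IsWeaklyMixing (Fin d → ℝ) μ → IsSimpleOfOrder (Fin d → ℝ) μ 2 →
      ∀ n : ℕ, 2 ≤ n → IsSimpleOfOrder (Fin d → ℝ) μ n) ∧
    (IsMixing (Fin d → ℝ) μ → IsSimpleOfOrder (Fin d → ℝ) μ 2 →
      ∀ k : ℕ, 1 ≤ k → IsMixingWithMultiplicity (Fin d → ℝ) μ k) ∧
    (IsWeaklyMixing (Fin d → ℝ) μ →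
      ∀ n : ℕ, 2 ≤ n →
        (HasMinimalSelfJoinings (Fin d → ℝ) μ 2 ↔ HasMinimalSelfJoinings (Fin d → ℝ) μ n)) := by
  have hmeas : MeasurableConstVAdd (Fin d → ℝ) X := ⟨fun t => (hT.measurePreserving t).measurable⟩
  have : Nonempty (Fin d) := ⟨⟨0, hd⟩⟩
  -- Here `d ≥ 1` matters: it makes the filter at infinity nontrivial, as the passage from mixing to
  -- weak mixing requires.
  have hnc : NoncompactSpace (Fin d → ℝ) := NormedSpace.noncompactSpace ℝ _
  refine ⟨fun hwm hs n _ => hs.of_two hT hwm n,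
    fun hmix hs k _ => hmix.isMixingWithMultiplicity hT hs k,
    fun hwm n hn => ⟨fun h => h.of_two hT hwm n, fun h => ?_⟩⟩
  induction n, hn using Nat.le_induction with
  | base => exact h
  | succ n _ ih => exact ih (h.of_succ hwm)
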